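/- **Setting.** Let $N,M\ge 1$. Let $J_1^o,\dots,J_N^o:\mathbb R^M\to\mathbb R$ be costs, $\pi_l>0$ weights and $J_l=\pi_lJ_l^o$. Let $A_1=[a_{1,lk}]$, $A_2=[a_{2,lk}]$ be $N\times N$ left-stochastic matrices and $C=[c_{lk}]$ an $N\times N$ right-stochastic matrix (nonnegative entries; $A_1^T\mathbb 1=A_2^T\mathbb 1=\mathbb 1$, $C\mathbb 1=\mathbb 1$). Each $J_l$ is twice differentiable with $\lambda_{l,\min}I\le\nabla^2J_l(w)\le\lambda_{l,\max}I$ for all $w$, where $\lambda_{l,\min},\lambda_{l,\max}\ge0$ and $\sigma_{k,\min}:=\sum_lc_{lk}\lambda_{l,\min}>0$ for every $k$. Put $\sigma_{k,\max}=\sum_lc_{lk}\lambda_{l,\max}$, $\sigma_{\min}=\min_k\sigma_{k,\min}$, $\sigma_{\max}=\max_k\sigma_{k,\max}$, $\lambda_{\max}=\max_l\lambda_{l,\max}$, and let $\|C\|_1$ be the maximum absolute column sum of $C$. For step sizes $\mu_1,\dots,\mu_N>0$ put $\Omega=\mathrm{diag}\{\mu_1,\dots,\mu_N\}$, $\mu_{\max}=\max_k\mu_k$,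 $\mu_{\min}=\min_k\mu_k$, $\beta=\mu_{\min}/\mu_{\max}$. For block vectors $x=\mathrm{col}\{x_1,\dots,x_N\}$ with $x_k\in\mathbb R^M$ let $T_A(x)=(A^T\otimes I_M)x$, let $T_G(x)$ have blocks $x_k-\mu_k\sum_lc_{lk}\nabla J_l(x_k)$, let $P[x]=\mathrm{col}\{\|x_1\|^2,\dots,\|x_N\|^2\}$, and let $T_d=T_{A_2}\circ T_G\circ T_{A_1}$. The noisy diffusion strategy with random noise fields $\boldsymbol v_{l,i}(\cdot)$ is $$\boldsymbol\phi_{k,i-1}=\sum_la_{1,lk}\boldsymbol w_{l,i-1},\qquad \boldsymbol\psi_{k,i}=\boldsymbol\phi_{k,i-1}-\mu_k\sum_lc_{lk}\big[\nabla J_l(\boldsymbol\phi_{k,i-1})+\boldsymbol v_{l,i}(\boldsymbol\phi_{k,i-1})\big],\qquad \boldsymbol w_{k,i}=\sum_la_{2,lk}\boldsymbol\psi_{l,i}\qquad(i\ge1),$$ with $\mathbb E\|\boldsymbol w_{k,0}\|^2<\infty$. Let $\mathcal F_{i-1}$ be generated by $\boldsymbol w_{k,j}$, $j\le i-1$, all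 $k$. For constants $\alpha\ge0$, $\sigma_v^2\ge 0$, all $l$, all $i\ge1$ and all square-integrable $\mathcal F_{i-1}$-measurable $\boldsymbol w$, the noise satisfies $\mathbb E\{\boldsymbol v_{l,i}(\boldsymbol w)\mid\mathcal F_{i-1}\}=0$ and $\mathbb E\|\boldsymbol v_{l,i}(\boldsymbol w)\|^2\le\alpha\,\mathbb E\|\nabla J_l(\boldsymbol w)\|^2+\sigma_v^2$. **Claim.** The aggregate cost $\sum_lJ_l$ has a unique minimizer $w^o$, and $w^o$ is Pareto optimal for $(J_1^o,\dots,J_N^o)$. For every $\beta_0>0$ there are $\mu_0>0$ and constants $K_1,K_2$ (depending on $\beta_0$, the costs, their Hessian bounds, $A_1,A_2,C,\alpha,\sigma_v^2$, but neither on the step sizes nor on the noise process and the initial vector) such that the following holds whenever $0<\mu_k\le\mu_0$ for all $k$ and $\beta\ge\beta_0$. The operator $T_d$ has exactly one fixed point $w_\infty=\mathrm{col}\{w_{1,\infty},\dots,w_{N,\infty}\}$. Let $$b_v=4\alpha\lambda_{\max}^2A_1^TP[w_\infty-\mathbb 1\otimes w^o]+\max_k\{2\alpha\|\nabla J_k(w^o)\|^2+\sigma_v^2\}\,\mathbb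 1,\qquad \Gamma_d=\Gamma^2+4\alpha\lambda_{\max}^2\|C\|_1^2\,\Omega^2,$$ where $\Gamma=\mathrm{diag}\{\gamma_1,\dots,\gamma_N\}$ and $\gamma_k=\max\{|1-\mu_k\sigma_{k,\max}|,|1-\mu_k\sigma_{k,\min}|\}$. Then $I-A_2^T\Gamma_dA_1^T$ is invertible; put $\mathrm{MSP}_\infty^{\mathrm{ub}}=\|C\|_1^2(I-A_2^T\Gamma_dA_1^T)^{-1}A_2^T\Omega^2b_v$. The denominator below is positive, and for every noisy diffusion process as above, the vectors $\mathrm{MSP}_i=\mathbb E\,P[\boldsymbol w_i-w_\infty]$ and $\mathrm{MSE}_i=\mathbb E\,P[\mathbb 1\otimes w^o-\boldsymbol w_i]$ are finite, bounded in $i$, and satisfy $$\limsup_{i\to\infty}\|\mathrm{MSP}_i\|_\infty\le\|\mathrm{MSP}_\infty^{\mathrm{ub}}\|_\infty\le\frac{\|C\|_1^2\,\|b_v\|_\infty\,\mu_{\max}}{2\beta\sigma_{\min}-\mu_{\max}\big(\sigma_{\max}^2+4\alpha\lambda_{\max}^2\|C\|_1^2\big)}\le K_1\mu_{\max},$$ $$\limsup_{i\to\infty}\|\mathrm{MSE}_i\|_\infty\le2\big\|P[\mathbb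 1\otimes w^o-w_\infty]\big\|_\infty+2\limsup_{i\to\infty}\|\mathrm{MSP}_i\|_\infty.$$ Suppose in addition that $A_2^TA_1^T$ is regular (some power of it has only positive entries) and that its left eigenvector $\theta^T$ of eigenvalue one satisfies $\theta^TA_2^T\Omega C^T=c_0\mathbb 1^T$ for some constant $c_0$. Then $\|\mathbb 1\otimes w^o-w_\infty\|^2\le K_2\mu_{\max}^2$ and $$\limsup_{i\to\infty}\|\mathrm{MSE}_i\|_\infty\le2K_1\mu_{\max}+2K_2\mu_{\max}^2,$$ so that, as the step sizes become small, all agents approach the same Pareto-optimal solution $w^o$. -/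

import Mathlib

open MeasureTheory ProbabilityTheory Filter Matrix

namespace DiffusionPareto

noncomputable section

/-- The space `ℝ^M` of decision vectors, with the Euclidean norm. -/
abbrev Vec (M : ℕ) : Type := EuclideanSpace ℝ (Fin M)

/-- Block vectors `col{x_1, …, x_N}` with blocks in `ℝ^M`. The norm of this function type is the
block maximum norm `max_k ‖x_k‖`. -/
abbrev BlockVec (N M : ℕ) : Type := Fin N → Vec M

variable {N M : ℕ}

/-! ### Costs -/

/-- `J` is twice differentiable and its Hessian satisfies `lmin I ≤ ∇² J(w) ≤ lmax I` for all `w`.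
The Hessian is the derivative of the gradient. -/
def HasHessianBounds (J : Vec M → ℝ) (lmin lmax : ℝ) : Prop :=
  Differentiable ℝ J ∧ Differentiable ℝ (gradient J) ∧
    ∀ w h : Vec M, lmin * ‖h‖ ^ 2 ≤ inner ℝ h (fderiv ℝ (gradient J) w h) ∧
      inner ℝ h (fderiv ℝ (gradient J) w h) ≤ lmax * ‖h‖ ^ 2

/-- `w` is Pareto optimal for the costs `Jo`: no other vector decreases one of the costs without
increasing another one. -/
def IsParetoOptimal (Jo : Fin N → Vec M → ℝ) (w : Vec M) : Prop :=
  ¬ ∃ w' : Vec M, (∀ l, Jo l w' ≤ Jo l w) ∧ ∃ k, Jo k w' < Jo k w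

/-! ### Operators -/

/-- The combination operator `T_A(x) = (Aᵀ ⊗ I) x`. -/
def combine (A : Matrix (Fin N) (Fin N) ℝ) (x : BlockVec N M) : BlockVec N M :=
  fun k => ∑ l, A l k • x l

/-- The gradient-descent operator `T_G`. -/
def gradDescent (C : Matrix (Fin N) (Fin N) ℝ) (J : Fin N → Vec M → ℝ) (μ : Fin N → ℝ)
    (x : BlockVec N M) : BlockVec N M :=
  fun k => x k - μ k • ∑ l, C l k • gradient (J l) (x k)

/-- The aggregate gradient noise `v(x)` built from noise fields `v_l`. -/
def aggregateNoise (C : Matrix (Fin N) (Fin N) ℝ) (μ : Fin N → ℝ) (v : Fin N → Vec M → Vec M)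
    (x : BlockVec N M) : BlockVec N M :=
  fun k => -(μ k • ∑ l, C l k • v l (x k))

/-- The diffusion operator `T_d = T_{A₂} ∘ T_G ∘ T_{A₁}`. -/
def diffusion (A₁ A₂ C : Matrix (Fin N) (Fin N) ℝ) (J : Fin N → Vec M → ℝ) (μ : Fin N → ℝ)
    (x : BlockVec N M) : BlockVec N M :=
  combine A₂ (gradDescent C J μ (combine A₁ x))

/-- The perturbed diffusion operator `T_{A₂} ∘ (T_G + v) ∘ T_{A₁}`. -/
def noisyDiffusion (A₁ A₂ C : Matrix (Fin N) (Fin N) ℝ) (J : Fin N → Vec M → ℝ) (μ : Fin N → ℝ)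
    (v : Fin N → Vec M → Vec M) (x : BlockVec N M) : BlockVec N M :=
  combine A₂ (gradDescent C J μ (combine A₁ x) + aggregateNoise C μ v (combine A₁ x))

/-- The power operator `P[x] = col{‖x_1‖², …, ‖x_N‖²}`. -/
def power (x : BlockVec N M) : Fin N → ℝ := fun k => ‖x k‖ ^ 2

/-- `E P[x]` for a random block vector `x`. -/
def meanPower {Ω : Type*} [MeasurableSpace Ω] (Pr : Measure Ω) (x : Ω → BlockVec N M) :
    Fin N → ℝ :=
  fun k => ∫ ω, power (x ω) k ∂Pr

/-! ### The stochastic recursion -/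

/-- The past history: the σ-algebra generated by the estimators `w_{k,j}` with `j ≤ i`. -/
abbrev pastHistory {Ω : Type*} (w : ℕ → Ω → BlockVec N M) (i : ℕ) : MeasurableSpace Ω :=
  ⨆ j : Fin (i + 1), MeasurableSpace.comap (w j) inferInstance

/-- The gradient noise model: for every square-integrable random vector `W` that is a function of
the past, the noise `v_{l,i+1}(W)` is conditionally centred given the past and
`E‖v_{l,i+1}(W)‖² ≤ α E‖∇J_l(W)‖² + σ_v²`. -/
def GradientNoise {Ω : Type*} [MeasurableSpace Ω] (Pr : Measure Ω) (J : Fin N → Vec M → ℝ)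
    (α σv : ℝ) (v : ℕ → Fin N → Vec M → Ω → Vec M) (w : ℕ → Ω → BlockVec N M) : Prop :=
  ∀ (i : ℕ) (l : Fin N) (W : Ω → Vec M), Measurable[pastHistory w i] W → MemLp W 2 Pr →
    MemLp (fun ω => v (i + 1) l (W ω) ω) 2 Pr ∧
    Pr[fun ω => v (i + 1) l (W ω) ω | pastHistory w i] =ᵐ[Pr] 0 ∧
    ∫ ω, ‖v (i + 1) l (W ω) ω‖ ^ 2 ∂Pr ≤ α * ∫ ω, ‖gradient (J l) (W ω)‖ ^ 2 ∂Pr + σv ^ 2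

/-- `w` is generated by the diffusion strategy with gradient noise `v` obeying the noise model with
constants `α`, `σ_v`, from a square-integrable initial vector `w 0`. -/
structure IsDiffusionProcess {Ω : Type*} [MeasurableSpace Ω] (Pr : Measure Ω)
    (A₁ A₂ C : Matrix (Fin N) (Fin N) ℝ) (J : Fin N → Vec M → ℝ) (μ : Fin N → ℝ) (α σv : ℝ)
    (v : ℕ → Fin N → Vec M → Ω → Vec M) (w : ℕ → Ω → BlockVec N M) : Prop where
  measurable_noise : ∀ i l, Measurable (fun p : Vec M × Ω => v i l p.1 p.2)
  measurable_init : Measurable (w 0)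
  memLp_init : MemLp (w 0) 2 Pr
  recursion : ∀ i ω,
    w (i + 1) ω = noisyDiffusion A₁ A₂ C J μ (fun l x => v (i + 1) l x ω) (w i ω)
  noise : GradientNoise Pr J α σv v w

/-! ### Constants -/

/-- `μ_max`. -/
def stepMax (μ : Fin N → ℝ) : ℝ := ⨆ k, μ k

/-- `μ_min`. -/
def stepMin (μ : Fin N → ℝ) : ℝ := ⨅ k, μ k

/-- `‖C‖₁`, the maximum absolute column sum. -/
def colSumNorm (C : Matrix (Fin N) (Fin N) ℝ) : ℝ := ⨆ k, ∑ l, |C l k|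

/-- `∑_l c_{lk} λ_l`: this is `σ_{k,min}` for `λ = λ_min` and `σ_{k,max}` for `λ = λ_max`. -/
def sigmaAt (C : Matrix (Fin N) (Fin N) ℝ) (lam : Fin N → ℝ) (k : Fin N) : ℝ :=
  ∑ l, C l k * lam l

/-- `σ_min = min_k σ_{k,min}`. -/
def sigmaMin (C : Matrix (Fin N) (Fin N) ℝ) (lmin : Fin N → ℝ) : ℝ := ⨅ k, sigmaAt C lmin k

/-- `σ_max = max_k σ_{k,max}`. -/
def sigmaMax (C : Matrix (Fin N) (Fin N) ℝ) (lmax : Fin N → ℝ) : ℝ := ⨆ k, sigmaAt C lmax k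

/-- `γ_k = max{|1 - μ_k σ_{k,max}|, |1 - μ_k σ_{k,min}|}`. -/
def gammaAt (C : Matrix (Fin N) (Fin N) ℝ) (lmin lmax μ : Fin N → ℝ) (k : Fin N) : ℝ :=
  max |1 - μ k * sigmaAt C lmax k| |1 - μ k * sigmaAt C lmin k|

/-- `4 α λ_max² ‖C‖₁²` with `λ_max = max_k λ_{k,max}`. -/
def noiseGain (C : Matrix (Fin N) (Fin N) ℝ) (lmax : Fin N → ℝ) (α : ℝ) : ℝ :=
  4 * α * (⨆ k, lmax k) ^ 2 * colSumNorm C ^ 2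

/-- `Γ_d = Γ² + 4 α λ_max² ‖C‖₁² Ω²`, where `Γ = diag{γ_k}` and `Ω = diag{μ_k}`. -/
def gammaD (C : Matrix (Fin N) (Fin N) ℝ) (lmin lmax : Fin N → ℝ) (α : ℝ) (μ : Fin N → ℝ) :
    Matrix (Fin N) (Fin N) ℝ :=
  diagonal (gammaAt C lmin lmax μ) ^ 2 + noiseGain C lmax α • diagonal μ ^ 2

/-- `b_v = 4 α λ_max² A₁ᵀ P[w_∞ - 1 ⊗ w°] + max_k {2 α ‖∇J_k(w°)‖² + σ_v²} 1`. -/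
def noiseVector (A₁ : Matrix (Fin N) (Fin N) ℝ) (J : Fin N → Vec M → ℝ) (lmax : Fin N → ℝ)
    (α σv : ℝ) (wo : Vec M) (winf : BlockVec N M) : Fin N → ℝ :=
  (4 * α * (⨆ k, lmax k) ^ 2) • (A₁ᵀ *ᵥ power (winf - fun _ => wo)) +
    fun _ => ⨆ k, (2 * α * ‖gradient (J k) wo‖ ^ 2 + σv ^ 2)

/-- `MSP_∞^ub = ‖C‖₁² (I - A₂ᵀ Γ_d A₁ᵀ)⁻¹ A₂ᵀ Ω² b_v`, where `bv` stands for `b_v`. -/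
def mspUpper (A₁ A₂ C : Matrix (Fin N) (Fin N) ℝ) (lmin lmax : Fin N → ℝ) (α : ℝ)
    (μ bv : Fin N → ℝ) : Fin N → ℝ :=
  colSumNorm C ^ 2 •
    (((1 - A₂ᵀ * gammaD C lmin lmax α μ * A₁ᵀ)⁻¹ * A₂ᵀ * diagonal μ ^ 2) *ᵥ bv)

/-- The denominator `2 β σ_min - μ_max (σ_max² + 4 α λ_max² ‖C‖₁²)` with `β = μ_min / μ_max`. -/
def boundDenom (C : Matrix (Fin N) (Fin N) ℝ) (lmin lmax : Fin N → ℝ) (α : ℝ)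
    (μ : Fin N → ℝ) : ℝ :=
  2 * (stepMin μ / stepMax μ) * sigmaMin C lmin -
    stepMax μ * (sigmaMax C lmax ^ 2 + noiseGain C lmax α)

/-- The hypotheses for small bias: `A₂ᵀ A₁ᵀ` is regular (some power has only positive entries), and
its left eigenvector `θᵀ` of eigenvalue one satisfies `θᵀ A₂ᵀ Ω Cᵀ = c₀ 1ᵀ` for some constant `c₀`.
-/
def SmallBiasCondition (A₁ A₂ C : Matrix (Fin N) (Fin N) ℝ) (μ : Fin N → ℝ) : Prop :=
  (A₂ᵀ * A₁ᵀ).IsPrimitive ∧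
    ∃ θ : Fin N → ℝ, θ ≠ 0 ∧ θ ᵥ* (A₂ᵀ * A₁ᵀ) = θ ∧
      ∃ c₀ : ℝ, θ ᵥ* (A₂ᵀ * diagonal μ * Cᵀ) = fun _ => c₀

end

end DiffusionPareto

/-! Two contractions in the maximum norm carry the proof. A gradient step on `localCost` has
derivative `I - μ_k H` with `H` symmetric and between `σ_{k,min}` and `σ_{k,max}`, so it is
`γ_k`-Lipschitz, and averaging with left-stochastic matrices does not enlarge the maximum norm.
Hence the diffusion operator contracts (`IsNetwork.norm_diffusion_sub_le`) and has one fixed point.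
The operator moves `1 ⊗ wo` by at most a multiple of `μ_max`, while the contraction gap is at least
`β₀ μ_max σ_min`; so the fixed point lies in a ball around `wo` whose radius is free of the steps,
and `b_v` is uniformly bounded.

For the mean squares, conditional centring kills the cross term and convexity of the square handles
the averaging. This gives the entrywise recursion of `IsDiffusionProcess.meanPower_succ_le`, whose
matrix `A₂ᵀ Γ_d A₁ᵀ` is nonnegative with maximum norm at most `1 - μ_max * boundDenom`. Since
`mspUpper` solves the recursion with equality, comparison shows that any excess over it decays
geometrically. Its own norm is `O(μ_max²)` divided by `μ_max * boundDenom`, which leaves one power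
of `μ_max`.

For the bias, the fixed-point equation says that `w_∞` is invariant under averaging up to
`O(μ_max)`; primitivity then makes all agents agree up to `O(μ_max)`. Pairing the equation with `θ`
cancels the averaging and leaves a vanishing weighted sum of local gradients. The condition on `θ`
makes the same weighted sum vanish at `wo`, and strong monotonicity forces the common part of the
error to be `O(μ_max)` (`IsNetwork.exists_bias_bound`). -/

namespace DiffusionPareto

variable {N M : ℕ}

/-! ### Calculus of costs with bounded Hessian -/

section Cost

/-- A symmetric operator whose quadratic form is bounded by `r` has norm at most `r`. -/
lemma norm_apply_le_of_abs_inner_le {E : Type*} [NormedAddCommGroup E] [InnerProductSpace ℝ E]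
    (T : E →L[ℝ] E) (hT : ∀ x y, inner ℝ (T x) y = inner ℝ x (T y)) {r : ℝ}
    (h : ∀ x, |inner ℝ x (T x)| ≤ r * ‖x‖ ^ 2) (x : E) : ‖T x‖ ≤ r * ‖x‖ := by
  have key : ∀ x y : E, 4 * inner ℝ x (T y) ≤ 2 * r * (‖x‖ ^ 2 + ‖y‖ ^ 2) := by
    intro x y
    have h1 := (abs_le.1 (h (x + y))).2
    have h2 := (abs_le.1 (h (x - y))).1
    have e1 : inner ℝ (x + y) (T (x + y)) - inner ℝ (x - y) (T (x - y)) = 4 * inner ℝ x (T y) := by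
      simp only [map_add, map_sub, inner_add_left, inner_add_right, inner_sub_left,
        inner_sub_right]
      rw [real_inner_comm (T x) y, hT x y]
      ring
    have e2 := parallelogram_law_with_norm ℝ x y
    have e3 : r * ‖x + y‖ ^ 2 + r * ‖x - y‖ ^ 2 = 2 * r * (‖x‖ ^ 2 + ‖y‖ ^ 2) := by
      rw [← mul_add, e2]
      ring
    linarith
  rcases eq_or_ne (T x) 0 with h0 | h0
  · by_cases hx : x = 0
    · simp [hx]
    · have h3 : (0 : ℝ) ≤ r * ‖x‖ ^ 2 := (abs_nonneg _).trans (h x)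
      have h4 : 0 < ‖x‖ := norm_pos_iff.2 hx
      rw [h0, norm_zero]
      nlinarith
  · have hTx : 0 < ‖T x‖ := norm_pos_iff.2 h0
    -- Rescaling `T x` to the length of `x` balances the two squares in the polarised bound, so no
    -- constant is lost.
    have h5 := key ((‖x‖ / ‖T x‖) • T x) x
    rw [real_inner_smul_left, real_inner_self_eq_norm_sq, norm_smul, Real.norm_of_nonneg
      (by positivity)] at h5
    have e3 : ‖x‖ / ‖T x‖ * ‖T x‖ ^ 2 = ‖x‖ * ‖T x‖ := by field_simp
    have e4 : ‖x‖ / ‖T x‖ * ‖T x‖ = ‖x‖ := by field_simp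
    rw [e3, e4] at h5
    have hx : 0 < ‖x‖ := norm_pos_iff.2 (by rintro rfl; simp at h0)
    nlinarith

variable {f : Vec M → ℝ} {a b : ℝ}

/-- Symmetry of second derivatives, carried from the differential to the gradient by the Riesz map.
It turns the quadratic-form bounds into operator-norm bounds. -/
lemma HasHessianBounds.symmetric (hf : HasHessianBounds f a b) (w x y : Vec M) :
    inner ℝ (fderiv ℝ (gradient f) w x) y = inner ℝ x (fderiv ℝ (gradient f) w y) := by
  have h1 : ∀ z, HasFDerivAt f (InnerProductSpace.toDual ℝ (Vec M) (gradient f z)) z :=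
    fun z => (hf.1 z).hasGradientAt.hasFDerivAt
  -- The Riesz map is conjugate-linear by type; over `ℝ` it is repackaged as a linear map so that
  -- the chain rule applies.
  let D : Vec M →L[ℝ] StrongDual ℝ (Vec M) := LinearMap.toContinuousLinearMap
    { toFun := fun z => InnerProductSpace.toDual ℝ (Vec M) z
      map_add' := by simp
      map_smul' := by simp }
  have h2 : HasFDerivAt (fun z => InnerProductSpace.toDual ℝ (Vec M) (gradient f z))
      (D.comp (fderiv ℝ (gradient f) w)) w :=
    D.hasFDerivAt.comp w (hf.2.1 w).hasFDerivAt
  have h3 := second_derivative_symmetric h1 h2 x y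
  simp only [ContinuousLinearMap.comp_apply] at h3
  change inner ℝ (fderiv ℝ (gradient f) w x) y = inner ℝ (fderiv ℝ (gradient f) w y) x at h3
  rw [h3, real_inner_comm]

lemma HasHessianBounds.le [NeZero M] (hf : HasHessianBounds f a b) : a ≤ b := by
  have h := hf.2.2 0 (EuclideanSpace.single 0 1)
  have := h.1.trans h.2
  simpa using this

lemma HasHessianBounds.continuous_gradient (hf : HasHessianBounds f a b) :
    Continuous (gradient f) := hf.2.1.continuous

/-- Mean value inequality: the derivative of the step is `I - r H`, symmetric with quadratic form
between `1 - r b` and `1 - r a`. -/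
lemma HasHessianBounds.norm_gradientStep_sub_le (hf : HasHessianBounds f a b) {r : ℝ}
    (hr : 0 ≤ r) (x y : Vec M) :
    ‖(x - r • gradient f x) - (y - r • gradient f y)‖ ≤
      max |1 - r * b| |1 - r * a| * ‖x - y‖ := by
  refine Convex.norm_image_sub_le_of_norm_hasFDerivWithin_le (s := Set.univ)
    (f := fun x => x - r • gradient f x)
    (f' := fun x => ContinuousLinearMap.id ℝ (Vec M) - r • fderiv ℝ (gradient f) x) ?_ ?_
    convex_univ (Set.mem_univ y) (Set.mem_univ x)
  · intro z _
    exact ((hasFDerivAt_id z).sub ((hf.2.1 z).hasFDerivAt.const_smul r)).hasFDerivWithinAt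
  · intro z _
    refine ContinuousLinearMap.opNorm_le_bound _ (le_max_of_le_left (abs_nonneg _)) fun h => ?_
    refine norm_apply_le_of_abs_inner_le _ ?_ ?_ h
    · intro x y
      simp only [_root_.sub_apply, _root_.smul_apply,
        ContinuousLinearMap.id_apply, inner_sub_left, inner_sub_right, real_inner_smul_left,
        real_inner_smul_right, hf.symmetric z x y]
    · intro h
      simp only [_root_.sub_apply, _root_.smul_apply,
        ContinuousLinearMap.id_apply, inner_sub_right, real_inner_smul_right,
        real_inner_self_eq_norm_sq]
      obtain ⟨h1, h2⟩ := hf.2.2 z h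
      have h3 := mul_le_mul_of_nonneg_left h1 hr
      have h4 := mul_le_mul_of_nonneg_left h2 hr
      have h5 := mul_le_mul_of_nonneg_right
        ((neg_le_neg (le_max_left |1 - r * b| |1 - r * a|)).trans (neg_abs_le (1 - r * b)))
        (sq_nonneg ‖h‖)
      have h6 := mul_le_mul_of_nonneg_right
        ((le_abs_self (1 - r * a)).trans (le_max_right |1 - r * b| |1 - r * a|)) (sq_nonneg ‖h‖)
      rw [abs_le]
      constructor <;> nlinarith

/-- The nonnegative lower bound makes the upper Hessian bound a bound on the absolute quadratic
form, hence on the norm of the Hessian. -/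
lemma HasHessianBounds.norm_gradient_sub_le [NeZero M] (hf : HasHessianBounds f a b) (ha : 0 ≤ a)
    (x y : Vec M) : ‖gradient f x - gradient f y‖ ≤ b * ‖x - y‖ := by
  refine Convex.norm_image_sub_le_of_norm_hasFDerivWithin_le (s := Set.univ)
    (fun z _ => (hf.2.1 z).hasFDerivAt.hasFDerivWithinAt) ?_ convex_univ (Set.mem_univ y)
    (Set.mem_univ x)
  intro z _
  have hq : ∀ h, |inner ℝ h (fderiv ℝ (gradient f) z h)| ≤ b * ‖h‖ ^ 2 := by
    intro h
    obtain ⟨h1, h2⟩ := hf.2.2 z h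
    rwa [abs_of_nonneg ((by positivity : 0 ≤ a * ‖h‖ ^ 2).trans h1)]
  exact ContinuousLinearMap.opNorm_le_bound _ (ha.trans hf.le)
    (norm_apply_le_of_abs_inner_le _ (hf.symmetric z) hq)

lemma HasHessianBounds.inner_gradient_sub_ge (hf : HasHessianBounds f a b) (x y : Vec M) :
    a * ‖x - y‖ ^ 2 ≤ inner ℝ (x - y) (gradient f x - gradient f y) := by
  have hd : ∀ t : ℝ, HasDerivAt (fun t : ℝ => inner ℝ (x - y) (gradient f (y + t • (x - y))))
      (inner ℝ (x - y) (fderiv ℝ (gradient f) (y + t • (x - y)) (x - y))) t := by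
    intro t
    have h1 : HasDerivAt (fun t : ℝ => y + t • (x - y)) (x - y) t := by
      simpa using ((hasDerivAt_id t).smul_const (x - y)).const_add y
    have h2 := (hf.2.1 (y + t • (x - y))).hasFDerivAt.comp_hasDerivAt t h1
    simpa using (hasDerivAt_const t (x - y)).inner ℝ h2
  have := Convex.mul_sub_le_image_sub_of_le_deriv (D := Set.univ) convex_univ
    (f := fun t : ℝ => inner ℝ (x - y) (gradient f (y + t • (x - y))))
    (fun t _ => (hd t).continuousAt.continuousWithinAt)
    (fun t _ => (hd t).differentiableAt.differentiableWithinAt)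
    (C := a * ‖x - y‖ ^ 2) (fun t _ => by rw [(hd t).deriv]; exact (hf.2.2 _ _).1)
    0 (Set.mem_univ _) 1 (Set.mem_univ _) zero_le_one
  simpa [inner_sub_right] using this

/-- A cost whose Hessian is bounded below by a positive constant has a unique minimizer, which is
the zero of its gradient. -/
lemma HasHessianBounds.exists_minimizer (hf : HasHessianBounds f a b) (ha : 0 < a) (hab : a ≤ b) :
    ∃ w, gradient f w = 0 ∧ ∀ x, x ≠ w → f w < f x := by
  have hb : 0 < b := ha.trans_le hab
  have hr : 0 < 1 / b := by positivity
  -- The step `1 / b` annihilates one term of the Lipschitz maximum and leaves `1 - a / b < 1`; the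
  -- fixed point is then a zero of the gradient.
  have hcontr : ContractingWith (Real.toNNReal (1 - a / b))
      (fun x => x - (1 / b) • gradient f x) := by
    have hab' : a / b ≤ 1 := (div_le_one hb).2 hab
    have hab0 : 0 < a / b := by positivity
    refine ⟨by rw [Real.toNNReal_lt_one]; linarith, LipschitzWith.of_dist_le_mul fun x y => ?_⟩
    rw [dist_eq_norm, dist_eq_norm, Real.coe_toNNReal _ (by linarith)]
    refine (hf.norm_gradientStep_sub_le hr.le x y).trans (le_of_eq ?_)
    have e1 : 1 - 1 / b * b = 0 := by field_simp; ring
    have e2 : 1 - 1 / b * a = 1 - a / b := by ring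
    rw [e1, e2, abs_zero, max_eq_right (abs_nonneg _), abs_of_nonneg (by linarith)]
  set w := ContractingWith.fixedPoint _ hcontr
  have hw : gradient f w = 0 := by
    have h1 : w - (1 / b) • gradient f w = w := hcontr.fixedPoint_isFixedPt
    have h2 : (1 / b) • gradient f w = 0 := by simpa using h1
    exact (smul_eq_zero.1 h2).resolve_left hr.ne'
  refine ⟨w, hw, fun x hx => ?_⟩
  have hpos : 0 < ‖x - w‖ := norm_pos_iff.2 (sub_ne_zero.2 hx)
  have hd : ∀ t : ℝ, HasDerivAt (fun t : ℝ => f (w + t • (x - w)))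
      (inner ℝ (gradient f (w + t • (x - w))) (x - w)) t := by
    intro t
    have h1 : HasDerivAt (fun t : ℝ => w + t • (x - w)) (x - w) t := by
      simpa using ((hasDerivAt_id t).smul_const (x - w)).const_add w
    have h2 := (hf.1 (w + t • (x - w))).hasFDerivAt.comp_hasDerivAt t h1
    rwa [← inner_gradient_left] at h2
  -- Minimality is checked along each ray from `w`: strong monotonicity of the gradient makes the
  -- radial derivative positive for `t > 0`.
  have hmono : StrictMonoOn (fun t : ℝ => f (w + t • (x - w))) (Set.Ici 0) := by
    refine strictMonoOn_of_deriv_pos (convex_Ici 0)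
      (fun t _ => (hd t).continuousAt.continuousWithinAt) fun t ht => ?_
    rw [interior_Ici, Set.mem_Ioi] at ht
    rw [(hd t).deriv]
    have h3 := hf.inner_gradient_sub_ge (w + t • (x - w)) w
    rw [hw, sub_zero, add_sub_cancel_left, real_inner_smul_left, norm_smul, mul_pow,
      real_inner_comm] at h3
    have h4 : 0 < a * (‖t‖ ^ 2 * ‖x - w‖ ^ 2) := by
      have : 0 < ‖t‖ := norm_pos_iff.2 ht.ne'
      positivity
    exact pos_of_mul_pos_right (h4.trans_le h3) ht.le
  simpa using hmono (Set.mem_Ici.2 le_rfl) (Set.mem_Ici.2 zero_le_one) zero_lt_one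

lemma gradient_sum {J : Fin N → Vec M → ℝ} (hJ : ∀ l, Differentiable ℝ (J l)) (c : Fin N → ℝ) :
    gradient (fun w => ∑ l, c l * J l w) = fun w => ∑ l, c l • gradient (J l) w := by
  refine gradient_eq fun w => ?_
  rw [hasGradientAt_iff_hasFDerivAt, map_sum]
  refine HasFDerivAt.fun_sum fun l _ => ?_
  have h := ((hJ l w).hasGradientAt.hasFDerivAt).const_mul (c l)
  simpa using h

lemma HasHessianBounds.sum {J : Fin N → Vec M → ℝ} {lmin lmax : Fin N → ℝ}
    (hJ : ∀ l, HasHessianBounds (J l) (lmin l) (lmax l)) {c : Fin N → ℝ} (hc : ∀ l, 0 ≤ c l) :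
    HasHessianBounds (fun w => ∑ l, c l * J l w) (∑ l, c l * lmin l) (∑ l, c l * lmax l) := by
  have hg := gradient_sum (fun l => (hJ l).1) c
  have hd : ∀ w, HasFDerivAt (fun w => ∑ l, c l • gradient (J l) w)
      (∑ l, c l • fderiv ℝ (gradient (J l)) w) w := fun w =>
    HasFDerivAt.fun_sum fun l _ => ((hJ l).2.1 w).hasFDerivAt.const_smul (c l)
  refine ⟨?_, ?_, fun w h => ?_⟩
  · exact Differentiable.fun_sum fun l _ => (hJ l).1.const_mul (c l)
  · rw [hg]
    exact fun w => (hd w).differentiableAt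
  · rw [hg, (hd w).fderiv]
    simp only [_root_.sum_apply, _root_.smul_apply, inner_sum,
      real_inner_smul_right, Finset.sum_mul, mul_assoc]
    exact ⟨Finset.sum_le_sum fun l _ => mul_le_mul_of_nonneg_left ((hJ l).2.2 w h).1 (hc l),
      Finset.sum_le_sum fun l _ => mul_le_mul_of_nonneg_left ((hJ l).2.2 w h).2 (hc l)⟩

end Cost

/-! ### Combination and gradient operators, and the contraction -/

section Operators

/-- Weighted Cauchy–Schwarz. The weights are not normalised because the lemma serves both the
columns of `A₁`, `A₂`, which sum to one, and those of `C`, which need not. -/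
lemma norm_sum_smul_sq_le {E : Type*} [NormedAddCommGroup E] [NormedSpace ℝ E] {a : Fin N → ℝ}
    (ha : ∀ l, 0 ≤ a l) (x : Fin N → E) :
    ‖∑ l, a l • x l‖ ^ 2 ≤ (∑ l, a l) * ∑ l, a l * ‖x l‖ ^ 2 := by
  have h1 : ‖∑ l, a l • x l‖ ≤ ∑ l, a l * ‖x l‖ := by
    refine (norm_sum_le _ _).trans (Finset.sum_le_sum fun l _ => ?_)
    rw [norm_smul, Real.norm_of_nonneg (ha l)]
  refine (pow_le_pow_left₀ (norm_nonneg _) h1 2).trans ?_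
  exact Finset.sum_sq_le_sum_mul_sum_of_sq_le_mul _ (fun l _ => ha l)
    (fun l _ => mul_nonneg (ha l) (sq_nonneg _)) fun l _ => le_of_eq (by ring)

lemma norm_combine_apply_sq_le {A : Matrix (Fin N) (Fin N) ℝ}
    (hA : A ∈ colStochastic ℝ (Fin N)) (x : BlockVec N M) (k : Fin N) :
    ‖combine A x k‖ ^ 2 ≤ ∑ l, A l k * ‖x l‖ ^ 2 := by
  have h := norm_sum_smul_sq_le (fun l => nonneg_of_mem_colStochastic hA (i := l) (j := k)) x
  rwa [sum_col_of_mem_colStochastic hA, one_mul] at h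

lemma norm_combine_le {A : Matrix (Fin N) (Fin N) ℝ} (hA : A ∈ colStochastic ℝ (Fin N))
    (x : BlockVec N M) : ‖combine A x‖ ≤ ‖x‖ := by
  refine (pi_norm_le_iff_of_nonneg (norm_nonneg _)).2 fun k => ?_
  refine (norm_sum_le _ _).trans ?_
  calc ∑ l, ‖A l k • x l‖ ≤ ∑ l, A l k * ‖x‖ := Finset.sum_le_sum fun l _ => by
        rw [norm_smul, Real.norm_of_nonneg (nonneg_of_mem_colStochastic hA)]
        exact mul_le_mul_of_nonneg_left (norm_le_pi_norm x l) (nonneg_of_mem_colStochastic hA)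
    _ = ‖x‖ := by rw [← Finset.sum_mul, sum_col_of_mem_colStochastic hA, one_mul]

lemma combine_sub (A : Matrix (Fin N) (Fin N) ℝ) (x y : BlockVec N M) :
    combine A (x - y) = combine A x - combine A y := by
  funext k
  simp [combine, smul_sub, Finset.sum_sub_distrib]

lemma combine_const {A : Matrix (Fin N) (Fin N) ℝ} (hA : A ∈ colStochastic ℝ (Fin N))
    (w : Vec M) : combine A (fun _ => w) = fun _ => w := by
  funext k
  simp only [combine]
  rw [← Finset.sum_smul, sum_col_of_mem_colStochastic hA, one_smul]

/-- The cost `∑_l c_{lk} J_l` that agent `k` descends. -/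
def localCost (C : Matrix (Fin N) (Fin N) ℝ) (J : Fin N → Vec M → ℝ) (k : Fin N) : Vec M → ℝ :=
  fun w => ∑ l, C l k * J l w

/-- The assumptions on the combination matrices and the costs. -/
structure IsNetwork (A₁ A₂ C : Matrix (Fin N) (Fin N) ℝ) (J : Fin N → Vec M → ℝ)
    (lmin lmax : Fin N → ℝ) : Prop where
  left₁ : A₁ ∈ colStochastic ℝ (Fin N)
  left₂ : A₂ ∈ colStochastic ℝ (Fin N)
  right : C ∈ rowStochastic ℝ (Fin N)
  lmin_nonneg : ∀ l, 0 ≤ lmin l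
  hessian : ∀ l, HasHessianBounds (J l) (lmin l) (lmax l)
  sigma_pos : ∀ k, 0 < sigmaAt C lmin k

variable {A₁ A₂ C : Matrix (Fin N) (Fin N) ℝ} {J : Fin N → Vec M → ℝ} {lmin lmax μ : Fin N → ℝ}

lemma IsNetwork.gradient_localCost (h : IsNetwork A₁ A₂ C J lmin lmax) (k : Fin N) (w : Vec M) :
    gradient (localCost C J k) w = ∑ l, C l k • gradient (J l) w :=
  congrFun (gradient_sum (fun l => (h.hessian l).1) fun l => C l k) w

lemma IsNetwork.hasHessianBounds_localCost (h : IsNetwork A₁ A₂ C J lmin lmax) (k : Fin N) :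
    HasHessianBounds (localCost C J k) (sigmaAt C lmin k) (sigmaAt C lmax k) :=
  HasHessianBounds.sum h.hessian fun _ => nonneg_of_mem_rowStochastic h.right

lemma IsNetwork.gradDescent_apply (h : IsNetwork A₁ A₂ C J lmin lmax) (μ : Fin N → ℝ)
    (x : BlockVec N M) (k : Fin N) :
    gradDescent C J μ x k = x k - μ k • gradient (localCost C J k) (x k) := by
  rw [h.gradient_localCost]
  rfl

lemma IsNetwork.norm_gradDescent_sub_le (h : IsNetwork A₁ A₂ C J lmin lmax) (hμ : ∀ k, 0 < μ k)
    (x y : BlockVec N M) (k : Fin N) :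
    ‖gradDescent C J μ x k - gradDescent C J μ y k‖ ≤
      gammaAt C lmin lmax μ k * ‖x k - y k‖ := by
  rw [h.gradDescent_apply, h.gradDescent_apply]
  exact (h.hasHessianBounds_localCost k).norm_gradientStep_sub_le (hμ k).le _ _

lemma le_stepMax (μ : Fin N → ℝ) (k : Fin N) : μ k ≤ stepMax μ :=
  le_ciSup (Set.finite_range μ).bddAbove k

lemma stepMin_le (μ : Fin N → ℝ) (k : Fin N) : stepMin μ ≤ μ k :=
  ciInf_le (Set.finite_range μ).bddBelow k

lemma sigmaMin_le (k : Fin N) : sigmaMin C lmin ≤ sigmaAt C lmin k :=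
  ciInf_le (Set.finite_range (sigmaAt C lmin)).bddBelow k

lemma le_sigmaMax (k : Fin N) : sigmaAt C lmax k ≤ sigmaMax C lmax :=
  le_ciSup (Set.finite_range (sigmaAt C lmax)).bddAbove k

lemma noiseGain_nonneg {α : ℝ} (hα : 0 ≤ α) : 0 ≤ noiseGain C lmax α := by
  unfold noiseGain
  positivity

lemma gammaAt_nonneg (k : Fin N) : 0 ≤ gammaAt C lmin lmax μ k :=
  le_max_of_le_left (abs_nonneg _)

variable [NeZero N]

lemma stepMax_pos (hμ : ∀ k, 0 < μ k) : 0 < stepMax μ := (hμ 0).trans_le (le_stepMax μ 0)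

lemma stepMin_pos (hμ : ∀ k, 0 < μ k) : 0 < stepMin μ := by
  obtain ⟨k, hk⟩ := exists_eq_ciInf_of_finite (f := μ)
  rw [stepMin, ← hk]
  exact hμ k

lemma IsNetwork.sigmaMin_pos (h : IsNetwork A₁ A₂ C J lmin lmax) : 0 < sigmaMin C lmin := by
  obtain ⟨k, hk⟩ := exists_eq_ciInf_of_finite (f := sigmaAt C lmin)
  rw [sigmaMin, ← hk]
  exact h.sigma_pos k

variable [NeZero M]

lemma IsNetwork.sigmaMin_le_sigmaMax (h : IsNetwork A₁ A₂ C J lmin lmax) :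
    sigmaMin C lmin ≤ sigmaMax C lmax :=
  (sigmaMin_le 0).trans ((h.hasHessianBounds_localCost 0).le.trans (le_sigmaMax 0))

/-- For such small steps both absolute values open with a plus sign. This linear bound is what the
contraction uses. -/
lemma IsNetwork.gammaAt_le (h : IsNetwork A₁ A₂ C J lmin lmax) (hμ : ∀ k, 0 < μ k)
    (hs : stepMax μ * sigmaMax C lmax ≤ 1) (k : Fin N) :
    gammaAt C lmin lmax μ k ≤ 1 - stepMin μ * sigmaMin C lmin := by
  have h1 : μ k * sigmaAt C lmin k ≤ μ k * sigmaAt C lmax k :=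
    mul_le_mul_of_nonneg_left (h.hasHessianBounds_localCost k).le (hμ k).le
  have h2 : μ k * sigmaAt C lmax k ≤ stepMax μ * sigmaMax C lmax :=
    mul_le_mul (le_stepMax μ k) (le_sigmaMax k)
      ((h.sigma_pos k).le.trans (h.hasHessianBounds_localCost k).le) (stepMax_pos hμ).le
  have h3 : stepMin μ * sigmaMin C lmin ≤ μ k * sigmaAt C lmin k :=
    mul_le_mul (stepMin_le μ k) (sigmaMin_le k) h.sigmaMin_pos.le (hμ k).le
  rw [gammaAt, abs_of_nonneg (by linarith), abs_of_nonneg (by linarith)]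
  exact max_le (by linarith) (by linarith)

/-- In `(1 - t)² = 1 - 2t + t²` the linear term takes the lower bound for `t` and the quadratic term
the upper one; no smallness of the steps is needed. -/
lemma IsNetwork.gammaAt_sq_le (h : IsNetwork A₁ A₂ C J lmin lmax) (hμ : ∀ k, 0 < μ k)
    (k : Fin N) : gammaAt C lmin lmax μ k ^ 2 ≤
      1 - 2 * stepMin μ * sigmaMin C lmin + stepMax μ ^ 2 * sigmaMax C lmax ^ 2 := by
  have h0 := h.sigma_pos k
  have h1 : μ k * sigmaAt C lmin k ≤ μ k * sigmaAt C lmax k :=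
    mul_le_mul_of_nonneg_left (h.hasHessianBounds_localCost k).le (hμ k).le
  have h2 : μ k * sigmaAt C lmax k ≤ stepMax μ * sigmaMax C lmax :=
    mul_le_mul (le_stepMax μ k) (le_sigmaMax k)
      (h0.le.trans (h.hasHessianBounds_localCost k).le) (stepMax_pos hμ).le
  have h3 : stepMin μ * sigmaMin C lmin ≤ μ k * sigmaAt C lmin k :=
    mul_le_mul (stepMin_le μ k) (sigmaMin_le k) h.sigmaMin_pos.le (hμ k).le
  have h4 : 0 < μ k * sigmaAt C lmin k := mul_pos (hμ k) h0
  rw [gammaAt, ← mul_pow]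
  have key : ∀ t, μ k * sigmaAt C lmin k ≤ t → t ≤ μ k * sigmaAt C lmax k →
      |1 - t| ^ 2 ≤ 1 - 2 * stepMin μ * sigmaMin C lmin + (stepMax μ * sigmaMax C lmax) ^ 2 := by
    intro t ht1 ht2
    rw [sq_abs]
    have : t ^ 2 ≤ (stepMax μ * sigmaMax C lmax) ^ 2 :=
      pow_le_pow_left₀ (h4.le.trans ht1) (ht2.trans h2) 2
    nlinarith
  rcases max_choice |1 - μ k * sigmaAt C lmax k| |1 - μ k * sigmaAt C lmin k| with e | e <;> rw [e]
  exacts [key _ h1 le_rfl, key _ le_rfl h1]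

lemma IsNetwork.norm_diffusion_sub_le (h : IsNetwork A₁ A₂ C J lmin lmax) (hμ : ∀ k, 0 < μ k)
    (hs : stepMax μ * sigmaMax C lmax ≤ 1) (x y : BlockVec N M) :
    ‖diffusion A₁ A₂ C J μ x - diffusion A₁ A₂ C J μ y‖ ≤
      (1 - stepMin μ * sigmaMin C lmin) * ‖x - y‖ := by
  have hγ := h.gammaAt_le hμ hs
  have h0 : 0 ≤ 1 - stepMin μ * sigmaMin C lmin := (gammaAt_nonneg 0).trans (hγ 0)
  rw [diffusion, diffusion, ← combine_sub]
  refine (norm_combine_le h.left₂ _).trans ?_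
  refine (pi_norm_le_iff_of_nonneg (mul_nonneg h0 (norm_nonneg _))).2 fun k => ?_
  refine (h.norm_gradDescent_sub_le hμ _ _ k).trans (mul_le_mul (hγ k) ?_ (norm_nonneg _) h0)
  rw [← Pi.sub_apply, ← combine_sub]
  exact (norm_le_pi_norm _ k).trans (norm_combine_le h.left₁ _)

lemma IsNetwork.exists_fixedPoint (h : IsNetwork A₁ A₂ C J lmin lmax) (hμ : ∀ k, 0 < μ k)
    (hs : stepMax μ * sigmaMax C lmax ≤ 1) :
    ∃ winf : BlockVec N M, ∀ x, diffusion A₁ A₂ C J μ x = x ↔ x = winf := by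
  have h0 : 0 ≤ 1 - stepMin μ * sigmaMin C lmin := (gammaAt_nonneg 0).trans (h.gammaAt_le hμ hs 0)
  have h1 : 0 < stepMin μ * sigmaMin C lmin := mul_pos (stepMin_pos hμ) h.sigmaMin_pos
  have hc : ContractingWith (Real.toNNReal (1 - stepMin μ * sigmaMin C lmin))
      (diffusion A₁ A₂ C J μ) := by
    refine ⟨by rw [Real.toNNReal_lt_one]; linarith, LipschitzWith.of_dist_le_mul fun x y => ?_⟩
    rw [dist_eq_norm, dist_eq_norm, Real.coe_toNNReal _ h0]
    exact h.norm_diffusion_sub_le hμ hs x y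
  refine ⟨ContractingWith.fixedPoint _ hc, fun x => ⟨fun hx => hc.fixedPoint_unique hx, ?_⟩⟩
  rintro rfl
  exact hc.fixedPoint_isFixedPt

/-- The fixed point stays at a distance from `wo` that is bounded independently of the steps. -/
lemma IsNetwork.norm_fixedPoint_sub_le (h : IsNetwork A₁ A₂ C J lmin lmax) (hμ : ∀ k, 0 < μ k)
    (hs : stepMax μ * sigmaMax C lmax ≤ 1) {β₀ : ℝ} (hβ₀ : 0 < β₀)
    (hβ : β₀ ≤ stepMin μ / stepMax μ) {winf : BlockVec N M}
    (hw : diffusion A₁ A₂ C J μ winf = winf) (wo : Vec M) {G : ℝ}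
    (hG : ∀ k, ‖gradient (localCost C J k) wo‖ ≤ G) :
    ‖winf - fun _ => wo‖ ≤ G / (β₀ * sigmaMin C lmin) := by
  have hσ := h.sigmaMin_pos
  have hm := stepMax_pos hμ
  have hG0 : 0 ≤ G := (norm_nonneg _).trans (hG 0)
  rw [le_div_iff₀ hm] at hβ
  have h1 : ‖diffusion A₁ A₂ C J μ (fun _ => wo) - fun _ => wo‖ ≤ stepMax μ * G := by
    have e : (fun _ => wo : BlockVec N M) = combine A₂ fun _ => wo :=
      (combine_const h.left₂ wo).symm
    rw [diffusion, combine_const h.left₁]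
    nth_rewrite 2 [e]
    rw [← combine_sub]
    refine (norm_combine_le h.left₂ _).trans ?_
    refine (pi_norm_le_iff_of_nonneg (mul_nonneg hm.le hG0)).2 fun k => ?_
    rw [Pi.sub_apply, h.gradDescent_apply, sub_sub_cancel_left, norm_neg, norm_smul,
      Real.norm_of_nonneg (hμ k).le]
    exact mul_le_mul (le_stepMax μ k) (hG k) (norm_nonneg _) hm.le
  have h2 := h.norm_diffusion_sub_le hμ hs winf fun _ => wo
  -- The usual a posteriori estimate for a contraction: distance to the fixed point times the gap is
  -- at most the displacement of `1 ⊗ wo`. The factor `μ_max` then cancels because `μ_min ≥ β₀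
  -- μ_max`.
  have h3 : ‖winf - fun _ => wo‖ ≤ ‖diffusion A₁ A₂ C J μ winf -
      diffusion A₁ A₂ C J μ (fun _ => wo)‖ +
        ‖diffusion A₁ A₂ C J μ (fun _ => wo) - fun _ => wo‖ := by
    conv_lhs => rw [← hw]
    exact norm_sub_le_norm_sub_add_norm_sub _ _ _
  have h4 : stepMin μ * sigmaMin C lmin * ‖winf - fun _ => wo‖ ≤ stepMax μ * G := by linarith
  have h5 : β₀ * stepMax μ * sigmaMin C lmin * ‖winf - fun _ => wo‖ ≤
      stepMin μ * sigmaMin C lmin * ‖winf - fun _ => wo‖ := by gcongr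
  rw [le_div_iff₀ (mul_pos hβ₀ hσ)]
  refine le_of_mul_le_mul_left ?_ hm
  calc stepMax μ * (‖winf - fun _ => wo‖ * (β₀ * sigmaMin C lmin)) =
      β₀ * stepMax μ * sigmaMin C lmin * ‖winf - fun _ => wo‖ := by ring
    _ ≤ _ := h5.trans h4

end Operators

/-! ### The comparison matrix and its steady state -/

section Comparison

variable {A₁ A₂ C : Matrix (Fin N) (Fin N) ℝ} {J : Fin N → Vec M → ℝ} {lmin lmax μ : Fin N → ℝ}
  {α : ℝ}

/-- The diagonal of `Γ_d`. -/
noncomputable def gammaDAt (C : Matrix (Fin N) (Fin N) ℝ) (lmin lmax : Fin N → ℝ) (α : ℝ) (μ : Fin N → ℝ)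
    (k : Fin N) : ℝ :=
  gammaAt C lmin lmax μ k ^ 2 + noiseGain C lmax α * μ k ^ 2

lemma gammaD_eq : gammaD C lmin lmax α μ = diagonal (gammaDAt C lmin lmax α μ) := by
  rw [gammaD, diagonal_pow, diagonal_pow, ← diagonal_smul, diagonal_add]
  rfl

lemma gammaDAt_nonneg (hα : 0 ≤ α) (k : Fin N) : 0 ≤ gammaDAt C lmin lmax α μ k :=
  add_nonneg (sq_nonneg _) (mul_nonneg (noiseGain_nonneg hα) (sq_nonneg _))

lemma transpose_mul_gammaD_mul_transpose_mulVec (x : Fin N → ℝ) (k : Fin N) :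
    ((A₂ᵀ * gammaD C lmin lmax α μ * A₁ᵀ) *ᵥ x) k =
      ∑ l, A₂ l k * (gammaDAt C lmin lmax α μ l * ∑ j, A₁ j l * x j) := by
  rw [gammaD_eq, ← mulVec_mulVec, ← mulVec_mulVec]
  simp only [mulVec, dotProduct, transpose_apply, diagonal_apply, ite_mul, zero_mul,
    Finset.sum_ite_eq, Finset.mem_univ, if_true]

lemma sum_mul_le_of_forall_le {A : Matrix (Fin N) (Fin N) ℝ} (hA : A ∈ colStochastic ℝ (Fin N))
    {x : Fin N → ℝ} {r : ℝ} (hx : ∀ j, x j ≤ r) (k : Fin N) : ∑ j, A j k * x j ≤ r := by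
  calc ∑ j, A j k * x j ≤ ∑ j, A j k * r := Finset.sum_le_sum fun j _ =>
        mul_le_mul_of_nonneg_left (hx j) (nonneg_of_mem_colStochastic hA)
    _ = r := by rw [← Finset.sum_mul, sum_col_of_mem_colStochastic hA, one_mul]

lemma abs_sum_mul_le {A : Matrix (Fin N) (Fin N) ℝ} (hA : A ∈ colStochastic ℝ (Fin N))
    {x : Fin N → ℝ} {r : ℝ} (hx : ∀ j, |x j| ≤ r) (k : Fin N) : |∑ j, A j k * x j| ≤ r := by
  refine (Finset.abs_sum_le_sum_abs _ _).trans ?_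
  simp only [abs_mul, abs_of_nonneg (nonneg_of_mem_colStochastic hA)]
  exact sum_mul_le_of_forall_le hA hx k

lemma sum_mul_mono {A : Matrix (Fin N) (Fin N) ℝ} (hA : A ∈ colStochastic ℝ (Fin N))
    {x y : Fin N → ℝ} (hxy : ∀ j, x j ≤ y j) (k : Fin N) :
    ∑ j, A j k * x j ≤ ∑ j, A j k * y j :=
  Finset.sum_le_sum fun j _ => mul_le_mul_of_nonneg_left (hxy j) (nonneg_of_mem_colStochastic hA)

lemma IsNetwork.transpose_mul_gammaD_mul_transpose_mulVec_mono
    (h : IsNetwork A₁ A₂ C J lmin lmax) (hα : 0 ≤ α) {x y : Fin N → ℝ} (hxy : x ≤ y) :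
    (A₂ᵀ * gammaD C lmin lmax α μ * A₁ᵀ) *ᵥ x ≤ (A₂ᵀ * gammaD C lmin lmax α μ * A₁ᵀ) *ᵥ y := by
  intro k
  rw [transpose_mul_gammaD_mul_transpose_mulVec, transpose_mul_gammaD_mul_transpose_mulVec]
  exact sum_mul_mono h.left₂ (fun l => mul_le_mul_of_nonneg_left (sum_mul_mono h.left₁ hxy l)
    (gammaDAt_nonneg hα l)) k

variable [NeZero N] [NeZero M]

/-- This is where `boundDenom` originates: multiplied by `μ_max`, it is the amount by which the
bounds on `γ_k²` and on the noise gain together fall short of one. -/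
lemma IsNetwork.gammaDAt_le (h : IsNetwork A₁ A₂ C J lmin lmax) (hα : 0 ≤ α)
    (hμ : ∀ k, 0 < μ k) (k : Fin N) :
    gammaDAt C lmin lmax α μ k ≤ 1 - stepMax μ * boundDenom C lmin lmax α μ := by
  have hm := stepMax_pos hμ
  have h1 := h.gammaAt_sq_le hμ k
  have h2 : noiseGain C lmax α * μ k ^ 2 ≤ noiseGain C lmax α * stepMax μ ^ 2 :=
    mul_le_mul_of_nonneg_left (pow_le_pow_left₀ (hμ k).le (le_stepMax μ k) 2)
      (noiseGain_nonneg hα)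
  have e : 1 - stepMax μ * boundDenom C lmin lmax α μ = 1 - 2 * stepMin μ * sigmaMin C lmin +
      stepMax μ ^ 2 * sigmaMax C lmax ^ 2 + noiseGain C lmax α * stepMax μ ^ 2 := by
    unfold boundDenom
    field_simp
    ring
  rw [e, gammaDAt]
  linarith

lemma IsNetwork.norm_transpose_mul_gammaD_mul_transpose_mulVec_le
    (h : IsNetwork A₁ A₂ C J lmin lmax) (hα : 0 ≤ α) (hμ : ∀ k, 0 < μ k) (x : Fin N → ℝ) :
    ‖(A₂ᵀ * gammaD C lmin lmax α μ * A₁ᵀ) *ᵥ x‖ ≤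
      (1 - stepMax μ * boundDenom C lmin lmax α μ) * ‖x‖ := by
  have h0 := (gammaDAt_nonneg hα 0).trans (h.gammaDAt_le hα hμ 0)
  refine (pi_norm_le_iff_of_nonneg (mul_nonneg h0 (norm_nonneg _))).2 fun k => ?_
  rw [transpose_mul_gammaD_mul_transpose_mulVec]
  refine abs_sum_mul_le h.left₂ (fun l => ?_) k
  rw [abs_mul, abs_of_nonneg (gammaDAt_nonneg hα l)]
  exact mul_le_mul (h.gammaDAt_le hα hμ l) (abs_sum_mul_le h.left₁ (norm_le_pi_norm x) l)
    (abs_nonneg _) h0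

lemma IsNetwork.isUnit_one_sub (h : IsNetwork A₁ A₂ C J lmin lmax) (hα : 0 ≤ α)
    (hμ : ∀ k, 0 < μ k) (hd : 0 < boundDenom C lmin lmax α μ) :
    IsUnit (1 - A₂ᵀ * gammaD C lmin lmax α μ * A₁ᵀ) := by
  rw [← mulVec_injective_iff_isUnit, ← coe_mulVecLin, injective_iff_map_eq_zero]
  intro x hx
  rw [mulVecLin_apply, sub_mulVec, one_mulVec, sub_eq_zero] at hx
  have h1 := h.norm_transpose_mul_gammaD_mul_transpose_mulVec_le hα hμ x
  rw [← hx] at h1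
  have h2 := mul_pos (stepMax_pos hμ) hd
  exact norm_le_zero_iff.1 (by nlinarith [norm_nonneg x])

/-- The inverse is traded for the fixed-point equation that it solves; later arguments use only this
equation. -/
lemma IsNetwork.mspUpper_eq (h : IsNetwork A₁ A₂ C J lmin lmax) (hα : 0 ≤ α)
    (hμ : ∀ k, 0 < μ k) (hd : 0 < boundDenom C lmin lmax α μ) (bv : Fin N → ℝ) (k : Fin N) :
    mspUpper A₁ A₂ C lmin lmax α μ bv k =
      ((A₂ᵀ * gammaD C lmin lmax α μ * A₁ᵀ) *ᵥ mspUpper A₁ A₂ C lmin lmax α μ bv) k +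
        ∑ l, A₂ l k * (colSumNorm C ^ 2 * μ l ^ 2 * bv l) := by
  have hu := (isUnit_iff_isUnit_det _).1 (h.isUnit_one_sub hα hμ hd)
  have h1 : (1 - A₂ᵀ * gammaD C lmin lmax α μ * A₁ᵀ) *ᵥ mspUpper A₁ A₂ C lmin lmax α μ bv =
      colSumNorm C ^ 2 • ((A₂ᵀ * diagonal μ ^ 2) *ᵥ bv) := by
    rw [mspUpper, mulVec_smul, mulVec_mulVec, Matrix.mul_assoc _ A₂ᵀ,
      mul_nonsing_inv_cancel_left _ _ hu]
  rw [sub_mulVec, one_mulVec] at h1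
  have h2 := congrFun h1 k
  rw [Pi.sub_apply, Pi.smul_apply, smul_eq_mul, diagonal_pow, ← mulVec_mulVec bv A₂ᵀ] at h2
  rw [← sub_eq_iff_eq_add', h2]
  simp only [mulVec, dotProduct, transpose_apply, diagonal_apply, ite_mul, zero_mul,
    Finset.sum_ite_eq, Finset.mem_univ, if_true, Finset.mul_sum, Pi.pow_apply]
  exact Finset.sum_congr rfl fun l _ => by ring

/-- Norms in the fixed-point equation give `μ_max * boundDenom * ‖x‖ ≤ ‖C‖₁² μ_max² ‖bv‖`, and one
factor `μ_max` cancels. -/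
lemma IsNetwork.norm_mspUpper_le (h : IsNetwork A₁ A₂ C J lmin lmax) (hα : 0 ≤ α)
    (hμ : ∀ k, 0 < μ k) (hd : 0 < boundDenom C lmin lmax α μ) (bv : Fin N → ℝ) :
    ‖mspUpper A₁ A₂ C lmin lmax α μ bv‖ ≤
      colSumNorm C ^ 2 * ‖bv‖ * stepMax μ / boundDenom C lmin lmax α μ := by
  have hm := stepMax_pos hμ
  have h0 := (gammaDAt_nonneg hα 0).trans (h.gammaDAt_le hα hμ 0)
  set x := mspUpper A₁ A₂ C lmin lmax α μ bv with hx
  have h1 : ‖x‖ ≤ (1 - stepMax μ * boundDenom C lmin lmax α μ) * ‖x‖ +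
      colSumNorm C ^ 2 * stepMax μ ^ 2 * ‖bv‖ := by
    refine (pi_norm_le_iff_of_nonneg (by positivity)).2 fun k => ?_
    rw [hx, h.mspUpper_eq hα hμ hd, ← hx]
    refine (norm_add_le _ _).trans (add_le_add ((norm_le_pi_norm _ k).trans
      (h.norm_transpose_mul_gammaD_mul_transpose_mulVec_le hα hμ x)) ?_)
    refine abs_sum_mul_le h.left₂ (fun l => ?_) k
    rw [abs_mul, abs_of_nonneg (by positivity)]
    exact mul_le_mul (mul_le_mul_of_nonneg_left
      (pow_le_pow_left₀ (hμ l).le (le_stepMax μ l) 2) (sq_nonneg _)) (norm_le_pi_norm bv l)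
      (abs_nonneg _) (by positivity)
  rw [le_div_iff₀ hd]
  refine le_of_mul_le_mul_left ?_ hm
  nlinarith

end Comparison

/-! ### Perron–Frobenius facts for primitive stochastic matrices -/

section Primitive

variable {W : Matrix (Fin N) (Fin N) ℝ}

/-- A fixed vector of a positive row-stochastic matrix is constant. -/
lemma apply_eq_of_mulVec_eq (hW : W ∈ rowStochastic ℝ (Fin N)) (hpos : ∀ i j, 0 < W i j)
    {x : Fin N → ℝ} (hx : W *ᵥ x = x) (i j : Fin N) : x i = x j := by
  have : Nonempty (Fin N) := ⟨i⟩
  -- Maximum principle: the largest entry is a positive average of all entries, so every entry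
  -- equals it.
  obtain ⟨k, hk⟩ := Finite.exists_max x
  have h1 : ∑ l, W k l * (x k - x l) = 0 := by
    have h2 := congrFun hx k
    simp only [mulVec, dotProduct] at h2
    simp only [mul_sub, Finset.sum_sub_distrib, h2, ← Finset.sum_mul,
      sum_row_of_mem_rowStochastic hW, one_mul, sub_self]
  have h3 : ∀ l, x k = x l := by
    intro l
    have h4 := (Finset.sum_eq_zero_iff_of_nonneg fun l _ =>
      mul_nonneg (hpos k l).le (sub_nonneg.2 (hk l))).1 h1 l (Finset.mem_univ l)
    exact sub_eq_zero.1 ((mul_eq_zero.1 h4).resolve_left (hpos k l).ne')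
  rw [← h3 i, ← h3 j]

lemma pow_mulVec_eq {x : Fin N → ℝ} (hx : W *ᵥ x = x) (m : ℕ) : W ^ m *ᵥ x = x := by
  induction m with
  | zero => simp
  | succ m ih => rw [pow_succ, ← mulVec_mulVec, hx, ih]

lemma vecMul_pow_eq {x : Fin N → ℝ} (hx : x ᵥ* W = x) (m : ℕ) : x ᵥ* W ^ m = x := by
  induction m with
  | zero => simp
  | succ m ih => rw [pow_succ, ← vecMul_vecMul, ih, hx]

/-- A left fixed vector of a primitive row-stochastic matrix has entries of one sign. -/
lemma nonneg_or_nonpos_of_vecMul_eq (hW : W ∈ rowStochastic ℝ (Fin N)) (hp : W.IsPrimitive)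
    {θ : Fin N → ℝ} (hθ : θ ᵥ* W = θ) : (∀ k, 0 ≤ θ k) ∨ ∀ k, θ k ≤ 0 := by
  obtain ⟨-, m, -, hm⟩ := hp
  have hR := pow_mem hW m
  have hθ' := vecMul_pow_eq hθ m
  by_contra hcon
  push Not at hcon
  obtain ⟨⟨a, ha⟩, b, hb⟩ := hcon
  -- With entries of both signs and a positive matrix, the triangle inequality is strict in each
  -- coordinate. Summing over coordinates contradicts the unit row sums.
  have h1 : ∀ k, |θ k| < ∑ l, |θ l| * (W ^ m) l k := by
    intro k
    have e : θ k = ∑ l, θ l * (W ^ m) l k := by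
      conv_lhs => rw [← hθ']
      rfl
    rw [e, abs_lt, ← Finset.sum_neg_distrib]
    constructor
    · refine Finset.sum_lt_sum (fun l _ => ?_) ⟨b, Finset.mem_univ b, ?_⟩
      · rw [← neg_mul]
        exact mul_le_mul_of_nonneg_right (neg_abs_le _) (hm l k).le
      · rw [← neg_mul]
        exact mul_lt_mul_of_pos_right (by rw [abs_of_pos hb]; linarith) (hm b k)
    · refine Finset.sum_lt_sum (fun l _ => ?_) ⟨a, Finset.mem_univ a, ?_⟩
      · exact mul_le_mul_of_nonneg_right (le_abs_self _) (hm l k).le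
      · exact mul_lt_mul_of_pos_right (by rw [abs_of_neg ha]; linarith) (hm a k)
  have h2 : ∑ k, |θ k| < ∑ k, ∑ l, |θ l| * (W ^ m) l k :=
    Finset.sum_lt_sum_of_nonempty ⟨a, Finset.mem_univ a⟩ fun k _ => h1 k
  rw [Finset.sum_comm] at h2
  simp only [← Finset.mul_sum, sum_row_of_mem_rowStochastic hR, mul_one, lt_self_iff_false] at h2

/-- For a primitive combination matrix the disagreement between the agents is controlled by the
defect `e - combine A e`. -/
lemma exists_norm_sub_le_of_isPrimitive [NeZero N] {A : Matrix (Fin N) (Fin N) ℝ}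
    (hA : A ∈ colStochastic ℝ (Fin N)) (hp : Aᵀ.IsPrimitive) :
    ∃ L : ℝ, 0 ≤ L ∧ ∀ (e : BlockVec N M) (k : Fin N),
      ‖e k - e 0‖ ≤ L * ‖e - combine A e‖ := by
  obtain ⟨-, m, -, hm⟩ := hp
  have hR := pow_mem (transpose_mem_rowStochastic_iff_mem_colStochastic.2 hA) m
  -- Averaging fixes exactly the constant block vectors, so recording `e 0` beside the defect makes
  -- the map injective. In finite dimension injectivity yields the antilipschitz constant `L`.
  let F : BlockVec N M →ₗ[ℝ] BlockVec N M × Vec M :=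
    { toFun := fun e => (e - combine A e, e 0)
      map_add' := fun x y => by
        refine Prod.ext ?_ rfl
        funext k
        simp only [combine, Pi.sub_apply, Pi.add_apply, smul_add, Finset.sum_add_distrib,
          Prod.fst_add]
        abel
      map_smul' := fun c x => by
        refine Prod.ext ?_ rfl
        funext k
        simp only [combine, Pi.sub_apply, Pi.smul_apply, Prod.smul_fst, RingHom.id_apply,
          smul_sub, Finset.smul_sum, smul_comm c] }
  have hF : LinearMap.ker F = ⊥ := by
    refine (LinearMap.ker_eq_bot').2 fun e he => ?_
    have h1 : e - combine A e = 0 := congrArg Prod.fst he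
    have h2 : e 0 = 0 := congrArg Prod.snd he
    rw [sub_eq_zero] at h1
    funext k
    ext i
    have h3 : Aᵀ *ᵥ (fun l => e l i) = fun l => e l i := by
      funext l
      have h4 := congrArg (fun v : Vec M => v i) (congrFun h1 l)
      simpa [combine, mulVec, dotProduct] using h4.symm
    have h5 := apply_eq_of_mulVec_eq hR hm (pow_mulVec_eq h3 m) k 0
    simpa [h2] using h5
  obtain ⟨L, -, hL⟩ := F.exists_antilipschitzWith hF
  refine ⟨L, L.2, fun e k => ?_⟩
  -- Subtracting the constant `e 0` leaves the defect unchanged and makes the second component of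
  -- `F` vanish.
  have h6 := hL.le_mul_dist (e - fun _ => e 0) 0
  rw [map_zero, dist_zero_right, dist_zero_right] at h6
  have h7 : F (e - fun _ => e 0) = (e - combine A e, 0) := by
    change ((e - fun _ => e 0) - combine A (e - fun _ => e 0), e 0 - e 0) = _
    rw [combine_sub, combine_const hA, sub_sub_sub_cancel_right, sub_self]
  rw [h7, Prod.norm_def, norm_zero, max_eq_left (norm_nonneg _)] at h6
  exact (norm_le_pi_norm (e - fun _ => e 0) k).trans h6

end Primitive

/-! ### Bias of the fixed point -/

section Bias

variable {A₁ A₂ C : Matrix (Fin N) (Fin N) ℝ} {J : Fin N → Vec M → ℝ} {lmin lmax μ : Fin N → ℝ}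

lemma combine_combine (A B : Matrix (Fin N) (Fin N) ℝ) (x : BlockVec N M) :
    combine B (combine A x) = combine (A * B) x := by
  funext k
  simp only [combine, Matrix.mul_apply, Finset.sum_smul, Finset.smul_sum, smul_smul]
  rw [Finset.sum_comm]
  simp only [mul_comm]

lemma sum_smul_combine (A : Matrix (Fin N) (Fin N) ℝ) (θ : Fin N → ℝ) (x : BlockVec N M) :
    ∑ k, θ k • combine A x k = ∑ l, (θ ᵥ* Aᵀ) l • x l := by
  simp only [combine, vecMul, dotProduct, transpose_apply, Finset.sum_smul, Finset.smul_sum,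
    smul_smul]
  rw [Finset.sum_comm]

variable [NeZero N] [NeZero M]

/-- If a positive combination of the local gradients vanishes both at `wo` and at points that are
`d`-close to `wo + e`, then `e` is small. -/
lemma IsNetwork.norm_le_of_sum_gradient_eq_zero (h : IsNetwork A₁ A₂ C J lmin lmax)
    {p : Fin N → ℝ} (hp : ∀ k, 0 ≤ p k) (hp0 : 0 < ∑ k, p k) {wo e : Vec M} {φ : BlockVec N M}
    {d : ℝ} (hφ : ∀ k, ‖φ k - (wo + e)‖ ≤ d)
    (h₁ : ∑ k, p k • gradient (localCost C J k) (φ k) = 0)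
    (h₂ : ∑ k, p k • gradient (localCost C J k) wo = 0) :
    ‖e‖ ≤ sigmaMax C lmax / sigmaMin C lmin * d := by
  have hσ := h.sigmaMin_pos
  have hd : 0 ≤ d := (norm_nonneg _).trans (hφ 0)
  have hσ' : 0 < sigmaMax C lmax := hσ.trans_le h.sigmaMin_le_sigmaMax
  -- Strong monotonicity between `wo` and `wo + e` gives the quadratic gain; the Lipschitz bound
  -- pays for replacing `wo + e` by `φ k`.
  have key : ∀ k, sigmaMin C lmin * ‖e‖ ^ 2 - sigmaMax C lmax * d * ‖e‖ ≤
      inner ℝ e (gradient (localCost C J k) (φ k) - gradient (localCost C J k) wo) := by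
    intro k
    have hk := h.hasHessianBounds_localCost k
    have h3 := hk.inner_gradient_sub_ge (wo + e) wo
    rw [add_sub_cancel_left] at h3
    have h4 := mul_le_mul_of_nonneg_right (sigmaMin_le (C := C) (lmin := lmin) k)
      (sq_nonneg ‖e‖)
    have h5 : ‖gradient (localCost C J k) (φ k) - gradient (localCost C J k) (wo + e)‖ ≤
        sigmaMax C lmax * d :=
      (hk.norm_gradient_sub_le (h.sigma_pos k).le _ _).trans
        (mul_le_mul (le_sigmaMax k) (hφ k) (norm_nonneg _) hσ'.le)
    have h6 := abs_le.1 (abs_real_inner_le_norm e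
      (gradient (localCost C J k) (φ k) - gradient (localCost C J k) (wo + e)))
    have h7 := mul_le_mul_of_nonneg_left h5 (norm_nonneg e)
    have e1 : gradient (localCost C J k) (φ k) - gradient (localCost C J k) wo =
        (gradient (localCost C J k) (φ k) - gradient (localCost C J k) (wo + e)) +
          (gradient (localCost C J k) (wo + e) - gradient (localCost C J k) wo) := by abel
    rw [e1, inner_add_right]
    linarith [h6.1]
  have h8 : (∑ k, p k) * (sigmaMin C lmin * ‖e‖ ^ 2 - sigmaMax C lmax * d * ‖e‖) ≤ 0 := by
    have h9 : ∑ k, p k * inner ℝ e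
        (gradient (localCost C J k) (φ k) - gradient (localCost C J k) wo) = 0 := by
      simp only [← real_inner_smul_right, ← inner_sum, smul_sub, Finset.sum_sub_distrib, h₁, h₂,
        sub_zero, inner_zero_right]
    rw [← h9, Finset.sum_mul]
    exact Finset.sum_le_sum fun k _ => mul_le_mul_of_nonneg_left (key k) (hp k)
  have h10 := nonpos_of_mul_nonpos_right h8 hp0
  rw [div_mul_eq_mul_div, le_div_iff₀ hσ]
  rcases (norm_nonneg e).eq_or_lt with h0 | h0
  · rw [← h0, zero_mul]
    positivity
  · exact le_of_mul_le_mul_left (by nlinarith) h0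

/-- Under the small bias condition the fixed point is `O(μ_max)`-close to the minimizer `wo`. -/
lemma IsNetwork.exists_bias_bound (h : IsNetwork A₁ A₂ C J lmin lmax)
    (hprim : (A₂ᵀ * A₁ᵀ).IsPrimitive) {wo : Vec M} (hwo : ∑ l, gradient (J l) wo = 0) :
    ∃ L : ℝ, 0 ≤ L ∧ ∀ (μ : Fin N → ℝ) (winf : BlockVec N M) (S : ℝ), (∀ k, 0 < μ k) →
      SmallBiasCondition A₁ A₂ C μ → diffusion A₁ A₂ C J μ winf = winf →
      (∀ k, ‖gradient (localCost C J k) (combine A₁ winf k)‖ ≤ S) →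
      ‖winf - fun _ => wo‖ ≤ L * S * stepMax μ := by
  have hA := mul_mem h.left₁ h.left₂
  rw [← transpose_mul] at hprim
  obtain ⟨L, hL0, hL⟩ := exists_norm_sub_le_of_isPrimitive (M := M) hA hprim
  have hσ := h.sigmaMin_pos
  have hσ' : 0 < sigmaMax C lmax := hσ.trans_le h.sigmaMin_le_sigmaMax
  refine ⟨(sigmaMax C lmax / sigmaMin C lmin + 1) * L, by positivity, ?_⟩
  intro μ winf S hμ hsb hfix hS
  have hm := stepMax_pos hμ
  have hS0 : 0 ≤ S := (norm_nonneg _).trans (hS 0)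
  set e : BlockVec N M := winf - fun _ => wo with he
  set s : BlockVec N M := fun k => μ k • gradient (localCost C J k) (combine A₁ winf k) with hs
  have hgd : gradDescent C J μ (combine A₁ winf) = combine A₁ winf - s := by
    funext k
    rw [h.gradDescent_apply, Pi.sub_apply]
  have hwinf : winf = combine (A₁ * A₂) winf - combine A₂ s := by
    conv_lhs => rw [← hfix, diffusion, hgd, combine_sub, combine_combine]
  have hdef : e - combine (A₁ * A₂) e = -combine A₂ s := by
    rw [he, combine_sub, combine_const hA, sub_sub_sub_cancel_right]
    nth_rewrite 1 [hwinf]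
    abel
  have hdn : ∀ k, ‖e k - e 0‖ ≤ L * S * stepMax μ := by
    intro k
    refine (hL e k).trans ?_
    rw [hdef, norm_neg, mul_assoc]
    refine mul_le_mul_of_nonneg_left ((norm_combine_le h.left₂ s).trans ?_) hL0
    refine (pi_norm_le_iff_of_nonneg (by positivity)).2 fun k => ?_
    rw [hs, norm_smul, Real.norm_of_nonneg (hμ k).le, mul_comm]
    exact mul_le_mul (hS k) (le_stepMax μ k) (hμ k).le hS0
  -- The points where gradients are taken are averages of the agents, hence as close to the common
  -- value `wo + e 0` as the agents themselves.
  have hφ : ∀ k, ‖combine A₁ winf k - (wo + e 0)‖ ≤ L * S * stepMax μ := by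
    intro k
    have e1 : combine A₁ winf k - (wo + e 0) = combine A₁ (e - fun _ => e 0) k := by
      rw [he, combine_sub, combine_sub, combine_const h.left₁, combine_const h.left₁]
      simp only [Pi.sub_apply]
      abel
    rw [e1]
    refine (norm_le_pi_norm _ k).trans ((norm_combine_le h.left₁ _).trans ?_)
    exact (pi_norm_le_iff_of_nonneg (by positivity)).2 hdn
  obtain ⟨-, θ₀, hθ₀, hfixθ₀, c₀', hc₀'⟩ := hsb
  -- The eigenvector is given only up to sign; primitivity makes its entries of one sign, and
  -- negating `c₀` along with it allows them to be taken nonnegative.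
  obtain ⟨θ, hθ, hfixθ, c₀, hc₀, hθnn⟩ : ∃ θ : Fin N → ℝ, θ ≠ 0 ∧ θ ᵥ* (A₂ᵀ * A₁ᵀ) = θ ∧
      ∃ c₀ : ℝ, θ ᵥ* (A₂ᵀ * diagonal μ * Cᵀ) = (fun _ => c₀) ∧ ∀ k, 0 ≤ θ k := by
    rw [transpose_mul] at hprim
    have hW : A₂ᵀ * A₁ᵀ ∈ rowStochastic ℝ (Fin N) := by
      rw [← transpose_mul]
      exact transpose_mem_rowStochastic_iff_mem_colStochastic.2 hA
    rcases nonneg_or_nonpos_of_vecMul_eq hW hprim hfixθ₀ with hn | hn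
    · exact ⟨θ₀, hθ₀, hfixθ₀, c₀', hc₀', hn⟩
    · refine ⟨-θ₀, neg_ne_zero.2 hθ₀, by rw [neg_vecMul, hfixθ₀], -c₀', ?_, fun k => ?_⟩
      · rw [neg_vecMul, hc₀']
        rfl
      · simpa using hn k
  set q := θ ᵥ* A₂ᵀ with hq
  have hqnn : ∀ k, 0 ≤ q k := fun k => show 0 ≤ ∑ j, θ j * A₂ k j from
    Finset.sum_nonneg fun j _ => mul_nonneg (hθnn j) (nonneg_of_mem_colStochastic h.left₂)
  -- If all weights vanished, `q` would be zero, and so would `θ`, which is `q` multiplied by `A₁ᵀ`.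
  have hqpos : 0 < ∑ k, q k * μ k := by
    refine (Finset.sum_nonneg fun k _ => mul_nonneg (hqnn k) (hμ k).le).lt_of_ne fun h0 => hθ ?_
    have h1 : ∀ k, q k = 0 := fun k => by
      have := (Finset.sum_eq_zero_iff_of_nonneg
        fun k _ => mul_nonneg (hqnn k) (hμ k).le).1 h0.symm k (Finset.mem_univ k)
      exact (mul_eq_zero.1 this).resolve_right (hμ k).ne'
    have h2 : q = 0 := funext h1
    rw [← hfixθ, ← vecMul_vecMul, ← hq, h2, zero_vecMul]
  -- Pairing with `θ` removes `winf` from the fixed-point equation, because `θ` is invariant under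
  -- the averaging.
  have hbal : ∑ k, (q k * μ k) • gradient (localCost C J k) (combine A₁ winf k) = 0 := by
    have h1 : ∑ k, θ k • combine A₂ s k = 0 := by
      have h2 : ∑ k, θ k • combine (A₁ * A₂) winf k = ∑ k, θ k • winf k := by
        rw [sum_smul_combine, transpose_mul, hfixθ]
      have h3 : ∀ k, combine A₂ s k = combine (A₁ * A₂) winf k - winf k := fun k => by
        have h4 : winf k = combine (A₁ * A₂) winf k - combine A₂ s k := congrFun hwinf k
        rw [h4, sub_sub_cancel]
      simp only [h3, smul_sub, Finset.sum_sub_distrib, h2, sub_self]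
    rw [sum_smul_combine, ← hq] at h1
    simpa only [hs, smul_smul] using h1
  -- Regrouped by cost instead of by agent, every `∇J_l(wo)` carries the same weight `c₀`, so the
  -- sum is `c₀` times the aggregate gradient.
  have hbal' : ∑ k, (q k * μ k) • gradient (localCost C J k) wo = 0 := by
    have h1 : ∀ l, ∑ k, q k * μ k * C l k = c₀ := fun l => by
      have h2 := congrFun hc₀ l
      rw [← vecMul_vecMul, ← vecMul_vecMul, ← hq] at h2
      change ∑ k, (q ᵥ* diagonal μ) k * C l k = c₀ at h2
      simpa only [vecMul_diagonal] using h2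
    simp only [h.gradient_localCost, Finset.smul_sum, smul_smul]
    rw [Finset.sum_comm]
    simp only [← Finset.sum_smul, h1, ← Finset.smul_sum, hwo, smul_zero]
  have he0 := h.norm_le_of_sum_gradient_eq_zero (fun k => mul_nonneg (hqnn k) (hμ k).le) hqpos hφ
    hbal hbal'
  refine (pi_norm_le_iff_of_nonneg (by positivity)).2 fun k => ?_
  calc ‖e k‖ ≤ ‖e k - e 0‖ + ‖e 0‖ := norm_le_norm_sub_add _ _
    _ ≤ L * S * stepMax μ + sigmaMax C lmax / sigmaMin C lmin * (L * S * stepMax μ) :=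
      add_le_add (hdn k) he0
    _ = _ := by ring

end Bias

/-! ### Second moments of the noisy recursion -/

section Stochastic

variable {Ω : Type*} {mΩ : MeasurableSpace Ω} {Pr : Measure Ω}

/-- A square-integrable vector that is centred given `m` is orthogonal to every `m`-measurable
square-integrable vector. -/
lemma integral_inner_eq_zero_of_condExp_eq_zero [IsFiniteMeasure Pr] {m : MeasurableSpace Ω} (hm : m ≤ mΩ)
    {X Y : Ω → Vec M} (hXm : StronglyMeasurable[m] X) (hX : MemLp X 2 Pr) (hY : MemLp Y 2 Pr)
    (h0 : Pr[Y | m] =ᵐ[Pr] 0) : ∫ ω, inner ℝ (X ω) (Y ω) ∂Pr = 0 := by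
  have hint : Integrable (fun ω => inner ℝ (X ω) (Y ω)) Pr := by
    refine (hX.norm.integrable_mul hY.norm).mono' (hX.1.inner hY.1) (ae_of_all _ fun ω => ?_)
    exact norm_inner_le_norm _ _
  have h1 := condExp_bilin_of_stronglyMeasurable_left (innerSL ℝ (E := Vec M)) hXm hint
    (hY.integrable one_le_two)
  have h2 := integral_condExp (μ := Pr) (f := fun ω => inner ℝ (X ω) (Y ω)) hm
  refine h2.symm.trans ((integral_congr_ae h1).trans (integral_eq_zero_of_ae ?_))
  filter_upwards [h0] with ω hω
  rw [hω]
  simp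

lemma integral_norm_sub_smul_sq [IsFiniteMeasure Pr] {m : MeasurableSpace Ω} (hm : m ≤ mΩ)
    {X Y : Ω → Vec M} (hXm : StronglyMeasurable[m] X) (hX : MemLp X 2 Pr) (hY : MemLp Y 2 Pr)
    (h0 : Pr[Y | m] =ᵐ[Pr] 0) (r : ℝ) :
    ∫ ω, ‖X ω - r • Y ω‖ ^ 2 ∂Pr = ∫ ω, ‖X ω‖ ^ 2 ∂Pr + r ^ 2 * ∫ ω, ‖Y ω‖ ^ 2 ∂Pr := by
  have hX2 := hX.integrable_norm_pow (p := 2) two_ne_zero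
  have hY2 := hY.integrable_norm_pow (p := 2) two_ne_zero
  have hint : Integrable (fun ω => inner ℝ (X ω) (Y ω)) Pr := by
    refine (hX.norm.integrable_mul hY.norm).mono' (hX.1.inner hY.1) (ae_of_all _ fun ω => ?_)
    exact norm_inner_le_norm _ _
  have e : ∀ ω, ‖X ω - r • Y ω‖ ^ 2 =
      ‖X ω‖ ^ 2 - 2 * r * inner ℝ (X ω) (Y ω) + r ^ 2 * ‖Y ω‖ ^ 2 := fun ω => by
    rw [norm_sub_sq_real, real_inner_smul_right, norm_smul, mul_pow, Real.norm_eq_abs, sq_abs]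
    ring
  simp only [e]
  have hc := hint.const_mul (2 * r)
  rw [integral_add (f := fun ω => ‖X ω‖ ^ 2 - 2 * r * inner ℝ (X ω) (Y ω)) (hX2.sub hc)
    (hY2.const_mul _), integral_sub hX2 hc, integral_const_mul, integral_const_mul,
    integral_inner_eq_zero_of_condExp_eq_zero hm hXm hX hY h0, mul_zero, sub_zero]

variable {A₁ A₂ C : Matrix (Fin N) (Fin N) ℝ} {J : Fin N → Vec M → ℝ}
  {lmin lmax μ : Fin N → ℝ} {α σv : ℝ} {v : ℕ → Fin N → Vec M → Ω → Vec M}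
  {w : ℕ → Ω → BlockVec N M}

lemma pastHistory_le (hw : ∀ i, Measurable (w i)) (i : ℕ) : pastHistory w i ≤ mΩ :=
  iSup_le fun j => (hw j).comap_le

lemma measurable_pastHistory (i : ℕ) : Measurable[pastHistory w i] (w i) :=
  measurable_iff_comap_le.2
    (le_iSup (fun j : Fin (i + 1) => MeasurableSpace.comap (w j) inferInstance) (Fin.last i))

lemma measurable_combine {m : MeasurableSpace Ω} (A : Matrix (Fin N) (Fin N) ℝ)
    {x : Ω → BlockVec N M} (hx : Measurable x) : Measurable fun ω => combine A (x ω) := by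
  refine measurable_pi_lambda _ fun k => ?_
  exact Finset.measurable_fun_sum _ fun l _ => ((measurable_pi_apply l).comp hx).const_smul (A l k)

lemma memLp_combine (A : Matrix (Fin N) (Fin N) ℝ) {x : Ω → BlockVec N M} (hx : MemLp x 2 Pr) :
    MemLp (fun ω => combine A (x ω)) 2 Pr :=
  MemLp.of_eval fun k => memLp_finsetSum _ fun l _ => (hx.eval l).const_smul (A l k)

/-- The noise that agent `k` sees at its intermediate estimate `φ_k`. -/
def localNoise (C : Matrix (Fin N) (Fin N) ℝ) (v : Fin N → Vec M → Ω → Vec M)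
    (φ : Ω → BlockVec N M) (k : Fin N) (ω : Ω) : Vec M :=
  ∑ l, C l k • v l (φ ω k) ω

lemma noisyDiffusion_apply (v : Fin N → Vec M → Ω → Vec M) (x : Ω → BlockVec N M) (ω : Ω) :
    noisyDiffusion A₁ A₂ C J μ (fun l z => v l z ω) (x ω) =
      combine A₂ (fun k => gradDescent C J μ (combine A₁ (x ω)) k -
        μ k • localNoise C v (fun ω => combine A₁ (x ω)) k ω) := by
  rw [noisyDiffusion]
  refine congrArg _ (funext fun k => ?_)
  rw [Pi.add_apply, aggregateNoise, ← sub_eq_add_neg, localNoise]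

lemma IsNetwork.continuous_gradDescent (h : IsNetwork A₁ A₂ C J lmin lmax) :
    Continuous (gradDescent (M := M) C J μ) := by
  refine continuous_pi fun k => ?_
  have hc := (h.hasHessianBounds_localCost k).continuous_gradient
  simp only [h.gradDescent_apply]
  fun_prop

/-- The noise field is evaluated at a random point, which is why its joint measurability in point
and outcome is needed. -/
lemma IsDiffusionProcess.measurable (h : IsNetwork A₁ A₂ C J lmin lmax)
    (hp : IsDiffusionProcess Pr A₁ A₂ C J μ α σv v w) (i : ℕ) : Measurable (w i) := by
  induction i with
  | zero => exact hp.measurable_init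
  | succ i ih =>
    have hφ := measurable_combine A₁ ih
    have e : w (i + 1) = fun ω => combine A₂ (fun k => gradDescent C J μ (combine A₁ (w i ω)) k -
        μ k • localNoise C (v (i + 1)) (fun ω => combine A₁ (w i ω)) k ω) :=
      funext fun ω => (hp.recursion i ω).trans (noisyDiffusion_apply _ _ _)
    rw [e]
    refine measurable_combine A₂ (measurable_pi_lambda _ fun k => ?_)
    refine ((measurable_pi_apply k).comp (h.continuous_gradDescent.measurable.comp hφ)).sub
      (Measurable.const_smul ?_ (μ k))
    refine Finset.measurable_fun_sum _ fun l _ => Measurable.const_smul ?_ (C l k)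
    exact (hp.measurable_noise (i + 1) l).comp
      (((measurable_pi_apply k).comp hφ).prodMk measurable_id)

lemma IsNetwork.memLp_gradDescent [IsFiniteMeasure Pr] (h : IsNetwork A₁ A₂ C J lmin lmax) (hμ : ∀ k, 0 < μ k)
    {x : Ω → BlockVec N M} (hx : MemLp x 2 Pr) (y : BlockVec N M) (k : Fin N) :
    MemLp (fun ω => gradDescent C J μ (x ω) k - gradDescent C J μ y k) 2 Pr := by
  refine MemLp.of_le_mul ((hx.eval k).sub (memLp_const (y k))) ?_
    (ae_of_all _ fun ω => h.norm_gradDescent_sub_le hμ (x ω) y k)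
  exact ((continuous_apply k).comp h.continuous_gradDescent).comp_aestronglyMeasurable hx.1
    |>.sub aestronglyMeasurable_const

lemma GradientNoise.memLp_localNoise (hn : GradientNoise Pr J α σv v w) {i : ℕ}
    {φ : Ω → BlockVec N M} (hφm : Measurable[pastHistory w i] φ) (hφ : MemLp φ 2 Pr)
    (k : Fin N) : MemLp (localNoise C (v (i + 1)) φ k) 2 Pr :=
  memLp_finsetSum _ fun l _ =>
    (hn i l _ ((measurable_pi_apply k).comp hφm) (hφ.eval k)).1.const_smul (C l k)

lemma GradientNoise.condExp_localNoise [IsFiniteMeasure Pr] (hn : GradientNoise Pr J α σv v w) {i : ℕ}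
    {φ : Ω → BlockVec N M} (hφm : Measurable[pastHistory w i] φ) (hφ : MemLp φ 2 Pr)
    (k : Fin N) : Pr[localNoise C (v (i + 1)) φ k | pastHistory w i] =ᵐ[Pr] 0 := by
  have hl := fun l => hn i l _ ((measurable_pi_apply k).comp hφm) (hφ.eval k)
  have e : localNoise C (v (i + 1)) φ k = ∑ l, C l k • fun ω => v (i + 1) l (φ ω k) ω := by
    funext ω
    simp [localNoise]
  rw [e]
  refine (condExp_finsetSum (fun l _ => ((hl l).1.integrable one_le_two).smul (C l k)) _).trans ?_
  have h1 : ∀ᵐ ω ∂Pr, ∀ l, (Pr[C l k • fun ω => v (i + 1) l (φ ω k) ω | pastHistory w i]) ω = 0 := by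
    rw [ae_all_iff]
    intro l
    filter_upwards [condExp_smul (μ := Pr) (C l k) (fun ω => v (i + 1) l (φ ω k) ω)
      (pastHistory w i), (hl l).2.1] with ω h2 h3
    rw [h2, Pi.smul_apply]
    exact (congrArg _ h3).trans (smul_zero _)
  filter_upwards [h1] with ω hω
  simp [hω]

lemma IsDiffusionProcess.memLp [IsFiniteMeasure Pr] (h : IsNetwork A₁ A₂ C J lmin lmax)
    (hμ : ∀ k, 0 < μ k)
    (hp : IsDiffusionProcess Pr A₁ A₂ C J μ α σv v w) (i : ℕ) : MemLp (w i) 2 Pr := by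
  induction i with
  | zero => exact hp.memLp_init
  | succ i ih =>
    have e : w (i + 1) = fun ω => combine A₂ (fun k => gradDescent C J μ (combine A₁ (w i ω)) k -
        μ k • localNoise C (v (i + 1)) (fun ω => combine A₁ (w i ω)) k ω) :=
      funext fun ω => (hp.recursion i ω).trans (noisyDiffusion_apply _ _ _)
    rw [e]
    refine memLp_combine A₂ (MemLp.of_eval fun k => MemLp.sub ?_ (MemLp.const_smul
      (hp.noise.memLp_localNoise (measurable_combine A₁ (measurable_pastHistory i))
        (memLp_combine A₁ ih) k) (μ k)))
    have h1 := (h.memLp_gradDescent hμ (memLp_combine A₁ ih) 0 k).add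
      (memLp_const (gradDescent C J μ (0 : BlockVec N M) k))
    refine h1.ae_eq (ae_of_all _ fun ω => ?_)
    simp

/-- The second moment of the local noise, in terms of the mean-square perturbation. -/
lemma IsNetwork.integral_norm_localNoise_sq_le [NeZero M] [IsProbabilityMeasure Pr]
    (h : IsNetwork A₁ A₂ C J lmin lmax)
    (hα : 0 ≤ α) (hn : GradientNoise Pr J α σv v w) {i : ℕ} {x : Ω → BlockVec N M}
    (hxm : Measurable[pastHistory w i] x) (hx : MemLp x 2 Pr) (wo : Vec M)
    (winf : BlockVec N M) (k : Fin N) :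
    ∫ ω, ‖localNoise C (v (i + 1)) (fun ω => combine A₁ (x ω)) k ω‖ ^ 2 ∂Pr ≤
      colSumNorm C ^ 2 * (4 * α * (⨆ k, lmax k) ^ 2 *
        ∫ ω, ‖combine A₁ (x ω) k - combine A₁ winf k‖ ^ 2 ∂Pr +
          noiseVector A₁ J lmax α σv wo winf k) := by
  set lam := ⨆ k, lmax k with hlam
  set φ := fun ω => combine A₁ (x ω) with hφdef
  have hφm : Measurable[pastHistory w i] φ := measurable_combine A₁ hxm
  have hφ : MemLp φ 2 Pr := memLp_combine A₁ hx
  have hC : ∀ l, 0 ≤ C l k := fun l => nonneg_of_mem_rowStochastic h.right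
  have hS0 : 0 ≤ ∑ l, C l k := Finset.sum_nonneg fun l _ => hC l
  have hS : ∑ l, C l k ≤ colSumNorm C := by
    have := le_ciSup (Set.finite_range fun k => ∑ l, |C l k|).bddAbove k
    refine le_trans (le_of_eq ?_) this
    exact Finset.sum_congr rfl fun l _ => (abs_of_nonneg (hC l)).symm
  have hl := fun l => hn i l (fun ω => φ ω k) ((measurable_pi_apply k).comp hφm) (hφ.eval k)
  have hlam' : ∀ l, lmax l ≤ lam := le_ciSup (Set.finite_range lmax).bddAbove
  have hd2 : Integrable (fun ω => ‖φ ω k - combine A₁ winf k‖ ^ 2) Pr :=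
    ((hφ.eval k).sub (memLp_const (combine A₁ winf k))).integrable_norm_pow (p := 2) two_ne_zero
  set E := ∫ ω, ‖φ ω k - combine A₁ winf k‖ ^ 2 ∂Pr with hE
  have hone : ∀ l, ∫ ω, ‖v (i + 1) l (φ ω k) ω‖ ^ 2 ∂Pr ≤
      4 * α * lam ^ 2 * E + noiseVector A₁ J lmax α σv wo winf k := by
    intro l
    refine (hl l).2.2.trans ?_
    -- The factor `4` in `b_v` and `Γ_d` comes from two uses of `(a + b)² ≤ 2a² + 2b²`: one splits
    -- off the gradient at `wo`, the other passes from `wo` to the averaged fixed point.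
    have hpt : ∀ z : Vec M, ‖gradient (J l) z‖ ^ 2 ≤
        4 * lam ^ 2 * ‖z - combine A₁ winf k‖ ^ 2 +
          (4 * lam ^ 2 * ‖combine A₁ winf k - wo‖ ^ 2 + 2 * ‖gradient (J l) wo‖ ^ 2) := by
      intro z
      have h1 : ‖gradient (J l) z - gradient (J l) wo‖ ≤ lam * ‖z - wo‖ :=
        ((h.hessian l).norm_gradient_sub_le (h.lmin_nonneg l) z wo).trans
          (mul_le_mul_of_nonneg_right (hlam' l) (norm_nonneg _))
      have h2 : ‖gradient (J l) z‖ ≤ ‖gradient (J l) z - gradient (J l) wo‖ +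
          ‖gradient (J l) wo‖ := norm_le_norm_sub_add _ _
      have h3 : ‖z - wo‖ ≤ ‖z - combine A₁ winf k‖ + ‖combine A₁ winf k - wo‖ :=
        norm_sub_le_norm_sub_add_norm_sub _ _ _
      have h4 := pow_le_pow_left₀ (norm_nonneg _) h1 2
      have h5 := (pow_le_pow_left₀ (norm_nonneg _) h2 2).trans add_sq_le
      have h6 := (pow_le_pow_left₀ (norm_nonneg _) h3 2).trans add_sq_le
      rw [mul_pow] at h4
      have h7 := mul_le_mul_of_nonneg_left h6 (sq_nonneg lam)
      linarith
    have hbound : ∫ ω, ‖gradient (J l) (φ ω k)‖ ^ 2 ∂Pr ≤ 4 * lam ^ 2 * E +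
          (4 * lam ^ 2 * ‖combine A₁ winf k - wo‖ ^ 2 + 2 * ‖gradient (J l) wo‖ ^ 2) := by
      calc ∫ ω, ‖gradient (J l) (φ ω k)‖ ^ 2 ∂Pr ≤
          ∫ ω, (4 * lam ^ 2 * ‖φ ω k - combine A₁ winf k‖ ^ 2 +
            (4 * lam ^ 2 * ‖combine A₁ winf k - wo‖ ^ 2 + 2 * ‖gradient (J l) wo‖ ^ 2)) ∂Pr :=
            integral_mono_of_nonneg (ae_of_all _ fun ω => sq_nonneg _)
              ((hd2.const_mul _).add (integrable_const _)) (ae_of_all _ fun ω => hpt _)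
        _ = _ := by
            rw [integral_add (hd2.const_mul _) (integrable_const _), integral_const_mul,
              integral_const, probReal_univ, one_smul]
    have h8 : ‖combine A₁ winf k - wo‖ ^ 2 ≤ (A₁ᵀ *ᵥ power (winf - fun _ => wo)) k := by
      have h9 := norm_combine_apply_sq_le h.left₁ (winf - fun _ => wo) k
      rw [combine_sub, combine_const h.left₁] at h9
      exact h9
    have h10 : 2 * α * ‖gradient (J l) wo‖ ^ 2 + σv ^ 2 ≤
        ⨆ k, (2 * α * ‖gradient (J k) wo‖ ^ 2 + σv ^ 2) :=
      le_ciSup (f := fun k => 2 * α * ‖gradient (J k) wo‖ ^ 2 + σv ^ 2)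
        (Set.finite_range _).bddAbove l
    have h11 := mul_le_mul_of_nonneg_left hbound hα
    have h12 := mul_le_mul_of_nonneg_left h8 (by positivity : 0 ≤ 4 * α * lam ^ 2)
    have e : noiseVector A₁ J lmax α σv wo winf k =
        4 * α * lam ^ 2 * (A₁ᵀ *ᵥ power (winf - fun _ => wo)) k +
          ⨆ k, (2 * α * ‖gradient (J k) wo‖ ^ 2 + σv ^ 2) := rfl
    rw [e]
    linarith
  have hint : ∀ l, Integrable (fun ω => C l k * ‖v (i + 1) l (φ ω k) ω‖ ^ 2) Pr := fun l =>
    ((hl l).1.integrable_norm_pow (p := 2) two_ne_zero).const_mul _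
  set B := 4 * α * lam ^ 2 * E + noiseVector A₁ J lmax α σv wo winf k with hB
  calc ∫ ω, ‖localNoise C (v (i + 1)) φ k ω‖ ^ 2 ∂Pr ≤
      ∫ ω, (∑ l, C l k) * ∑ l, C l k * ‖v (i + 1) l (φ ω k) ω‖ ^ 2 ∂Pr :=
        integral_mono_of_nonneg (ae_of_all _ fun ω => sq_nonneg _)
          ((integrable_finsetSum _ fun l _ => hint l).const_mul _)
          (ae_of_all _ fun ω => norm_sum_smul_sq_le hC _)
    _ = (∑ l, C l k) * ∑ l, C l k * ∫ ω, ‖v (i + 1) l (φ ω k) ω‖ ^ 2 ∂Pr := by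
        rw [integral_const_mul, integral_finsetSum _ fun l _ => hint l]
        simp only [integral_const_mul]
    _ ≤ (∑ l, C l k) * ∑ l, C l k * B := mul_le_mul_of_nonneg_left
        (Finset.sum_le_sum fun l _ => mul_le_mul_of_nonneg_left (hone l) (hC l)) hS0
    _ = (∑ l, C l k) ^ 2 * B := by rw [← Finset.sum_mul]; ring
    _ ≤ colSumNorm C ^ 2 * B := by
        refine mul_le_mul_of_nonneg_right (pow_le_pow_left₀ hS0 hS 2) ?_
        -- `B` is nonnegative because it dominates a second moment; any noise index would serve, and
        -- `k` is at hand.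
        exact (integral_nonneg fun ω => sq_nonneg ‖v (i + 1) k (φ ω k) ω‖).trans (hone k)

lemma integral_norm_combine_sq_le {A : Matrix (Fin N) (Fin N) ℝ}
    (hA : A ∈ colStochastic ℝ (Fin N)) {x : Ω → BlockVec N M} (hx : MemLp x 2 Pr) (k : Fin N) :
    ∫ ω, ‖combine A (x ω) k‖ ^ 2 ∂Pr ≤ ∑ l, A l k * ∫ ω, ‖x ω l‖ ^ 2 ∂Pr := by
  have hint : ∀ l, Integrable (fun ω => A l k * ‖x ω l‖ ^ 2) Pr := fun l =>
    ((hx.eval l).integrable_norm_pow (p := 2) two_ne_zero).const_mul _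
  calc ∫ ω, ‖combine A (x ω) k‖ ^ 2 ∂Pr ≤ ∫ ω, ∑ l, A l k * ‖x ω l‖ ^ 2 ∂Pr :=
        integral_mono_of_nonneg (ae_of_all _ fun ω => sq_nonneg _)
          (integrable_finsetSum _ fun l _ => hint l)
          (ae_of_all _ fun ω => norm_combine_apply_sq_le hA _ k)
    _ = _ := by
        rw [integral_finsetSum _ fun l _ => hint l]
        simp only [integral_const_mul]

/-- The one-step variance recursion for the mean-square perturbation. -/
lemma IsDiffusionProcess.meanPower_succ_le [NeZero M] [IsProbabilityMeasure Pr]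
    (h : IsNetwork A₁ A₂ C J lmin lmax)
    (hμ : ∀ k, 0 < μ k) (hα : 0 ≤ α) (hp : IsDiffusionProcess Pr A₁ A₂ C J μ α σv v w)
    (wo : Vec M) {winf : BlockVec N M} (hfix : diffusion A₁ A₂ C J μ winf = winf) (i : ℕ)
    (k : Fin N) :
    meanPower Pr (fun ω => w (i + 1) ω - winf) k ≤
      ((A₂ᵀ * gammaD C lmin lmax α μ * A₁ᵀ) *ᵥ meanPower Pr (fun ω => w i ω - winf)) k +
        ∑ l, A₂ l k * (colSumNorm C ^ 2 * μ l ^ 2 * noiseVector A₁ J lmax α σv wo winf l) := by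
  have hwm := hp.measurable h
  have hm := pastHistory_le hwm i
  have hx := hp.memLp h hμ i
  have hxm := measurable_pastHistory (w := w) i
  have hφ := memLp_combine A₁ hx
  have hφm := measurable_combine A₁ hxm
  set φ := fun ω => combine A₁ (w i ω) with hφdef
  set n := localNoise C (v (i + 1)) φ with hn
  have hnL : ∀ k, MemLp (n k) 2 Pr := hp.noise.memLp_localNoise hφm hφ
  set D : Ω → BlockVec N M := fun ω k =>
    gradDescent C J μ (φ ω) k - gradDescent C J μ (combine A₁ winf) k with hD
  have hDL : ∀ k, MemLp (fun ω => D ω k) 2 Pr := h.memLp_gradDescent hμ hφ _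
  have hDm : ∀ k, StronglyMeasurable[pastHistory w i] fun ω => D ω k := fun k =>
    (((measurable_pi_apply k).comp (h.continuous_gradDescent.measurable.comp hφm)).sub
      measurable_const).stronglyMeasurable
  have hstep : ∀ ω, w (i + 1) ω - winf = combine A₂ fun k => D ω k - μ k • n k ω := by
    intro ω
    rw [hp.recursion, noisyDiffusion_apply (v (i + 1)) (w i) ω]
    conv_lhs => rw [← hfix]
    rw [diffusion, ← combine_sub]
    congr 1
    funext k
    simp only [Pi.sub_apply, hD]
    abel
  have hloc : ∀ l, ∫ ω, ‖D ω l - μ l • n l ω‖ ^ 2 ∂Pr ≤ gammaDAt C lmin lmax α μ l *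
      ∑ j, A₁ j l * meanPower Pr (fun ω => w i ω - winf) j +
        colSumNorm C ^ 2 * μ l ^ 2 * noiseVector A₁ J lmax α σv wo winf l := by
    intro l
    have h1 := integral_norm_sub_smul_sq hm (hDm l) (hDL l) (hnL l)
      (hp.noise.condExp_localNoise hφm hφ l) (μ l)
    have h2 := h.integral_norm_localNoise_sq_le hα hp.noise hxm hx wo winf l
    set E := ∫ ω, ‖φ ω l - combine A₁ winf l‖ ^ 2 ∂Pr with hE
    have h3 : ∫ ω, ‖D ω l‖ ^ 2 ∂Pr ≤ gammaAt C lmin lmax μ l ^ 2 * E := by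
      rw [hE, ← integral_const_mul]
      refine integral_mono_of_nonneg (ae_of_all _ fun ω => sq_nonneg _)
        ((((hφ.eval l).sub (memLp_const _)).integrable_norm_pow (p := 2) two_ne_zero).const_mul _)
        (ae_of_all _ fun ω => ?_)
      simp only [← mul_pow]
      exact pow_le_pow_left₀ (norm_nonneg _) (h.norm_gradDescent_sub_le hμ _ _ l) 2
    have h4 : E ≤ ∑ j, A₁ j l * meanPower Pr (fun ω => w i ω - winf) j := by
      have h5 := integral_norm_combine_sq_le h.left₁ (hx.sub (memLp_const winf)) l
      simp only [Pi.sub_apply, combine_sub] at h5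
      exact h5
    have h6 := mul_le_mul_of_nonneg_left h2 (sq_nonneg (μ l))
    have h7 := mul_le_mul_of_nonneg_left h4
      (gammaDAt_nonneg (C := C) (lmin := lmin) (lmax := lmax) (μ := μ) hα l)
    -- The part of the noise variance proportional to `E` joins the contraction factor `γ_l²`; this
    -- is how `Γ²` becomes `Γ_d`.
    have e : gammaDAt C lmin lmax α μ l * E = gammaAt C lmin lmax μ l ^ 2 * E +
        μ l ^ 2 * (colSumNorm C ^ 2 * (4 * α * (⨆ k, lmax k) ^ 2 * E)) := by
      rw [gammaDAt, noiseGain]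
      ring
    rw [h1]
    linarith
  have hL : MemLp (fun ω => (fun k => D ω k - μ k • n k ω : BlockVec N M)) 2 Pr :=
    MemLp.of_eval fun k => (hDL k).sub ((hnL k).const_smul (μ k))
  rw [transpose_mul_gammaD_mul_transpose_mulVec, ← Finset.sum_add_distrib]
  simp only [← mul_add]
  refine le_trans ?_ (sum_mul_mono h.left₂ hloc k)
  simp only [meanPower, power, hstep]
  exact integral_norm_combine_sq_le h.left₂ hL k

end Stochastic

/-! ### Passage to the limit superior -/

section SteadyState

variable {Ω : Type*} {mΩ : MeasurableSpace Ω} {Pr : Measure Ω}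
  {A₁ A₂ C : Matrix (Fin N) (Fin N) ℝ} {J : Fin N → Vec M → ℝ}
  {lmin lmax μ : Fin N → ℝ} {α σv : ℝ} {v : ℕ → Fin N → Vec M → Ω → Vec M}
  {w : ℕ → Ω → BlockVec N M}

lemma meanPower_nonneg (x : Ω → BlockVec N M) (k : Fin N) : 0 ≤ meanPower Pr x k :=
  integral_nonneg fun _ => sq_nonneg _

/-- Comparison principle: the nonnegative matrix preserves entrywise inequalities, so the mean
powers stay below `x` plus a uniform excess that shrinks by `ρ` at each step. -/
lemma IsDiffusionProcess.norm_meanPower_le [NeZero N] [NeZero M] [IsProbabilityMeasure Pr]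
    (h : IsNetwork A₁ A₂ C J lmin lmax) (hμ : ∀ k, 0 < μ k) (hα : 0 ≤ α)
    (hd : 0 < boundDenom C lmin lmax α μ)
    (hp : IsDiffusionProcess Pr A₁ A₂ C J μ α σv v w) (wo : Vec M) {winf : BlockVec N M}
    (hfix : diffusion A₁ A₂ C J μ winf = winf) :
    ∃ D : ℝ, ∀ i, ‖meanPower Pr (fun ω => w i ω - winf)‖ ≤
      ‖mspUpper A₁ A₂ C lmin lmax α μ (noiseVector A₁ J lmax α σv wo winf)‖ +
        (1 - stepMax μ * boundDenom C lmin lmax α μ) ^ i * D := by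
  set x := mspUpper A₁ A₂ C lmin lmax α μ (noiseVector A₁ J lmax α σv wo winf) with hx
  set ρ := 1 - stepMax μ * boundDenom C lmin lmax α μ with hρ
  have hρ0 : 0 ≤ ρ := (gammaDAt_nonneg hα 0).trans (h.gammaDAt_le hα hμ 0)
  set D := ‖meanPower Pr (fun ω => w 0 ω - winf) - x‖ with hD
  have key : ∀ i, meanPower Pr (fun ω => w i ω - winf) ≤ x + (ρ ^ i * D) • (1 : Fin N → ℝ) := by
    intro i
    induction i with
    | zero =>
      intro k
      have h1 := (le_abs_self _).trans
        (norm_le_pi_norm (meanPower Pr (fun ω => w 0 ω - winf) - x) k)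
      simp only [Pi.sub_apply] at h1
      simp only [pow_zero, one_mul, Pi.add_apply, Pi.smul_apply, Pi.one_apply, smul_eq_mul,
        mul_one]
      linarith
    | succ i ih =>
      intro k
      have h1 := hp.meanPower_succ_le h hμ hα wo hfix i k
      have h2 := h.transpose_mul_gammaD_mul_transpose_mulVec_mono (μ := μ) hα ih k
      have h3 := h.mspUpper_eq hα hμ hd (noiseVector A₁ J lmax α σv wo winf) k
      rw [← hx] at h3
      -- Testing the norm bound on the all-ones vector bounds every row sum by `ρ`.
      have h4 := (le_abs_self _).trans ((norm_le_pi_norm _ k).trans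
        (h.norm_transpose_mul_gammaD_mul_transpose_mulVec_le hα hμ 1))
      rw [← hρ, Pi.norm_def] at h4
      simp only [Pi.one_apply, nnnorm_one, Finset.sup_const Finset.univ_nonempty, NNReal.coe_one,
        mul_one] at h4
      rw [mulVec_add, mulVec_smul, Pi.add_apply, Pi.smul_apply, smul_eq_mul] at h2
      have h5 := mul_le_mul_of_nonneg_left h4
        (mul_nonneg (pow_nonneg hρ0 i) (norm_nonneg _) : 0 ≤ ρ ^ i * D)
      simp only [Pi.add_apply, Pi.smul_apply, Pi.one_apply, smul_eq_mul, mul_one, pow_succ]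
      linarith
  refine ⟨D, fun i => (pi_norm_le_iff_of_nonneg (by positivity)).2 fun k => ?_⟩
  rw [Real.norm_of_nonneg (meanPower_nonneg _ k)]
  have h1 := key i k
  simp only [Pi.add_apply, Pi.smul_apply, Pi.one_apply, smul_eq_mul, mul_one] at h1
  have h2 := (le_abs_self _).trans (norm_le_pi_norm x k)
  linarith

lemma norm_meanPower_sub_le [IsProbabilityMeasure Pr] {x : Ω → BlockVec N M} (hx : MemLp x 2 Pr)
    (y z : BlockVec N M) :
    ‖meanPower Pr (fun ω => z - x ω)‖ ≤
      2 * ‖power (z - y)‖ + 2 * ‖meanPower Pr (fun ω => x ω - y)‖ := by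
  refine (pi_norm_le_iff_of_nonneg (by positivity)).2 fun k => ?_
  rw [Real.norm_of_nonneg (meanPower_nonneg _ k)]
  have hint : Integrable (fun ω => ‖x ω k - y k‖ ^ 2) Pr :=
    ((hx.eval k).sub (memLp_const (y k))).integrable_norm_pow (p := 2) two_ne_zero
  have h1 : meanPower Pr (fun ω => z - x ω) k ≤
      ∫ ω, (2 * ‖z k - y k‖ ^ 2 + 2 * ‖x ω k - y k‖ ^ 2) ∂Pr := by
    refine integral_mono_of_nonneg (ae_of_all _ fun ω => sq_nonneg _)
      ((integrable_const _).add (hint.const_mul _)) (ae_of_all _ fun ω => ?_)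
    have h2 : ‖z k - x ω k‖ ≤ ‖z k - y k‖ + ‖x ω k - y k‖ := by
      rw [norm_sub_rev (x ω k)]
      exact norm_sub_le_norm_sub_add_norm_sub _ _ _
    have h3 := (pow_le_pow_left₀ (norm_nonneg _) h2 2).trans add_sq_le
    simp only [power, Pi.sub_apply]
    linarith
  rw [integral_add (integrable_const _) (hint.const_mul _), integral_const, probReal_univ,
    one_smul, integral_const_mul] at h1
  have h4 := (le_abs_self _).trans (norm_le_pi_norm (power (z - y)) k)
  have h5 := (le_abs_self _).trans (norm_le_pi_norm (meanPower Pr fun ω => x ω - y) k)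
  change ‖z k - y k‖ ^ 2 ≤ _ at h4
  change ∫ ω, ‖x ω k - y k‖ ^ 2 ∂Pr ≤ _ at h5
  linarith

/-- Boundedness is returned with the estimate, since a real `limsup` is meaningful only for bounded
sequences and the next comparison needs it. -/
lemma limsup_le_of_le_add_pow_mul {u : ℕ → ℝ} (hu : ∀ i, 0 ≤ u i) {a ρ D : ℝ} (hρ0 : 0 ≤ ρ)
    (hρ1 : ρ < 1) (h : ∀ i, u i ≤ a + ρ ^ i * D) :
    IsBoundedUnder (· ≤ ·) atTop u ∧ limsup u atTop ≤ a := by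
  have ht : Tendsto (fun i => a + ρ ^ i * D) atTop (nhds a) := by
    simpa using ((tendsto_pow_atTop_nhds_zero_of_lt_one hρ0 hρ1).mul_const D).const_add a
  refine ⟨ht.isBoundedUnder_le.mono_le (Eventually.of_forall h), ?_⟩
  rw [← ht.limsup_eq]
  exact limsup_le_limsup (Eventually.of_forall h)
    (isBoundedUnder_of ⟨0, hu⟩ : IsBoundedUnder (· ≥ ·) atTop u).isCoboundedUnder_le
    ht.isBoundedUnder_le

lemma limsup_le_add_mul_limsup {u y : ℕ → ℝ} (hu : ∀ i, 0 ≤ u i) (hy : ∀ i, 0 ≤ y i) {a c : ℝ}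
    (hc : 0 ≤ c) (hyb : IsBoundedUnder (· ≤ ·) atTop y) (h : ∀ i, u i ≤ a + c * y i) :
    IsBoundedUnder (· ≤ ·) atTop u ∧ limsup u atTop ≤ a + c * limsup y atTop := by
  have hmono : Monotone fun t : ℝ => a + c * t := fun s t hst => by
    simpa using mul_le_mul_of_nonneg_left hst hc
  have hb : IsBoundedUnder (· ≤ ·) atTop fun i => a + c * y i :=
    hmono.isBoundedUnder_le_comp hyb
  refine ⟨hb.mono_le (Eventually.of_forall h), ?_⟩
  have e := hmono.map_limsup_of_continuousAt y (by fun_prop) hyb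
    (isBoundedUnder_of ⟨0, hy⟩ : IsBoundedUnder (· ≥ ·) atTop y).isCoboundedUnder_le
  rw [e]
  exact limsup_le_limsup (Eventually.of_forall h)
    (isBoundedUnder_of ⟨0, hu⟩ : IsBoundedUnder (· ≥ ·) atTop u).isCoboundedUnder_le hb

end SteadyState

/-! ### Minimizer and constants uniform in the step sizes -/

section Constants

variable {A₁ A₂ C : Matrix (Fin N) (Fin N) ℝ} {J : Fin N → Vec M → ℝ} {lmin lmax μ : Fin N → ℝ}
  {α σv : ℝ}

lemma IsNetwork.exists_minimizer [NeZero N] [NeZero M] (h : IsNetwork A₁ A₂ C J lmin lmax) :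
    ∃ wo : Vec M, ∑ l, gradient (J l) wo = 0 ∧ ∀ w, w ≠ wo → ∑ l, J l wo < ∑ l, J l w := by
  have hs := HasHessianBounds.sum h.hessian fun _ => zero_le_one
  -- Were the sum zero, every `lmin l` would vanish, and with them `σ_{0,min}`.
  have hpos : 0 < ∑ l, (1 : ℝ) * lmin l := by
    simp only [one_mul]
    refine (Finset.sum_nonneg fun l _ => h.lmin_nonneg l).lt_of_ne fun h0 =>
      (h.sigma_pos 0).ne' ?_
    have h1 := (Finset.sum_eq_zero_iff_of_nonneg fun l _ => h.lmin_nonneg l).1 h0.symm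
    exact Finset.sum_eq_zero fun l hl => by rw [h1 l hl, mul_zero]
  obtain ⟨wo, h1, h2⟩ := hs.exists_minimizer hpos hs.le
  rw [gradient_sum (fun l => (h.hessian l).1) fun _ => 1] at h1
  simp only [one_smul, one_mul] at h1 h2
  exact ⟨wo, h1, h2⟩

lemma isParetoOptimal_of_minimizer {Jo : Fin N → Vec M → ℝ} {π : Fin N → ℝ}
    (hπ : ∀ l, 0 < π l) (hJ : ∀ l w, J l w = π l * Jo l w) {wo : Vec M}
    (hwo : ∀ w, w ≠ wo → ∑ l, J l wo < ∑ l, J l w) : IsParetoOptimal Jo wo := by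
  rintro ⟨w', h1, k, hk⟩
  have hne : w' ≠ wo := by
    rintro rfl
    exact lt_irrefl _ hk
  refine (hwo w' hne).not_ge (Finset.sum_le_sum fun l _ => ?_)
  rw [hJ, hJ]
  exact mul_le_mul_of_nonneg_left (h1 l) (hπ l).le

lemma norm_noiseVector_le (hA₁ : A₁ ∈ colStochastic ℝ (Fin N)) (hα : 0 ≤ α) {wo : Vec M}
    {winf : BlockVec N M} {R : ℝ} (hR : ‖winf - fun _ => wo‖ ≤ R) :
    ‖noiseVector A₁ J lmax α σv wo winf‖ ≤ 4 * α * (⨆ k, lmax k) ^ 2 * R ^ 2 +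
      ⨆ k, (2 * α * ‖gradient (J k) wo‖ ^ 2 + σv ^ 2) := by
  have hs : 0 ≤ ⨆ k, (2 * α * ‖gradient (J k) wo‖ ^ 2 + σv ^ 2) :=
    Real.iSup_nonneg fun k => by positivity
  refine (pi_norm_le_iff_of_nonneg (by positivity)).2 fun k => ?_
  refine (norm_add_le _ _).trans (add_le_add ?_ (Real.norm_of_nonneg hs).le)
  rw [Pi.smul_apply, norm_smul, Real.norm_of_nonneg (by positivity)]
  refine mul_le_mul_of_nonneg_left ?_ (by positivity)
  refine abs_sum_mul_le hA₁ (fun j => ?_) k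
  rw [power, abs_of_nonneg (sq_nonneg _)]
  exact pow_le_pow_left₀ (norm_nonneg _) ((norm_le_pi_norm _ j).trans hR) 2

lemma IsNetwork.le_boundDenom [NeZero N] (h : IsNetwork A₁ A₂ C J lmin lmax) {β₀ : ℝ}
    (hβ : β₀ ≤ stepMin μ / stepMax μ)
    (hs : stepMax μ * (sigmaMax C lmax ^ 2 + noiseGain C lmax α) ≤ β₀ * sigmaMin C lmin) :
    β₀ * sigmaMin C lmin ≤ boundDenom C lmin lmax α μ := by
  have h1 := mul_le_mul_of_nonneg_right hβ h.sigmaMin_pos.le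
  rw [boundDenom]
  linarith

/-- A uniform bound for the constant in `‖1 ⊗ wo - w_∞‖² ≤ K μ_max²`. -/
lemma IsNetwork.exists_sum_sq_le [NeZero N] [NeZero M] (h : IsNetwork A₁ A₂ C J lmin lmax) {wo : Vec M}
    (hwo : ∑ l, gradient (J l) wo = 0) (R : ℝ) :
    ∃ K : ℝ, ∀ (μ : Fin N → ℝ) (winf : BlockVec N M), (∀ k, 0 < μ k) →
      SmallBiasCondition A₁ A₂ C μ → diffusion A₁ A₂ C J μ winf = winf →
      ‖winf - fun _ => wo‖ ≤ R → ∑ k, ‖wo - winf k‖ ^ 2 ≤ K * stepMax μ ^ 2 := by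
  -- `K` must be chosen before `μ`. Primitivity does not involve `μ`, so it can be decided here; if
  -- it fails, the bias claim is vacuous.
  by_cases hprim : (A₂ᵀ * A₁ᵀ).IsPrimitive
  swap
  · exact ⟨0, fun μ winf _ hsb => absurd hsb.1 hprim⟩
  obtain ⟨L, hL0, hL⟩ := h.exists_bias_bound hprim hwo
  set S := sigmaMax C lmax * R + ∑ k, ‖gradient (localCost C J k) wo‖ with hS
  refine ⟨N * (L * S) ^ 2, fun μ winf hμ hsb hfix hR => ?_⟩
  have hσ' : 0 ≤ sigmaMax C lmax := h.sigmaMin_pos.le.trans h.sigmaMin_le_sigmaMax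
  have hgrad : ∀ k, ‖gradient (localCost C J k) (combine A₁ winf k)‖ ≤ S := by
    intro k
    have h1 : ‖combine A₁ winf k - wo‖ ≤ R := by
      have h2 := (norm_le_pi_norm _ k).trans (norm_combine_le h.left₁ (winf - fun _ => wo))
      rw [combine_sub, combine_const h.left₁] at h2
      exact h2.trans hR
    have h3 := ((h.hasHessianBounds_localCost k).norm_gradient_sub_le (h.sigma_pos k).le
      (combine A₁ winf k) wo).trans (mul_le_mul (le_sigmaMax k) h1 (norm_nonneg _) hσ')
    have h4 : ‖gradient (localCost C J k) wo‖ ≤ ∑ k, ‖gradient (localCost C J k) wo‖ :=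
      Finset.single_le_sum (f := fun k => ‖gradient (localCost C J k) wo‖)
        (fun _ _ => norm_nonneg _) (Finset.mem_univ k)
    exact (norm_le_norm_sub_add _ _).trans (add_le_add h3 h4)
  have h5 := hL μ winf S hμ hsb hfix hgrad
  calc ∑ k, ‖wo - winf k‖ ^ 2 ≤ ∑ _k : Fin N, (L * S * stepMax μ) ^ 2 :=
        Finset.sum_le_sum fun k _ => by
          rw [norm_sub_rev]
          exact pow_le_pow_left₀ (norm_nonneg _)
            ((norm_le_pi_norm (winf - fun _ => wo) k).trans h5) 2
    _ = N * (L * S) ^ 2 * stepMax μ ^ 2 := by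
        rw [Finset.sum_const, Finset.card_univ, Fintype.card_fin, nsmul_eq_mul]
        ring

end Constants

end DiffusionPareto

/-! ### Assembly of the theorem -/

theorem mainTheorem4 {N M : ℕ} [NeZero N] [NeZero M]
    -- the original costs, the positive weights, and the weighted costs
    (Jo J : Fin N → DiffusionPareto.Vec M → ℝ) (π : Fin N → ℝ) (hπ : ∀ l, 0 < π l)
    (hJ : ∀ l w, J l w = π l * Jo l w)
    -- `A₁`, `A₂` are left-stochastic and `C` is right-stochastic
    (A₁ A₂ C : Matrix (Fin N) (Fin N) ℝ)
    (hA₁ : A₁ ∈ Matrix.colStochastic ℝ (Fin N)) (hA₂ : A₂ ∈ Matrix.colStochastic ℝ (Fin N))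
    (hC : C ∈ Matrix.rowStochastic ℝ (Fin N))
    -- bounded Hessians
    (lmin lmax : Fin N → ℝ) (hlmin : ∀ l, 0 ≤ lmin l) (hlmax : ∀ l, 0 ≤ lmax l)
    (hHess : ∀ l, DiffusionPareto.HasHessianBounds (J l) (lmin l) (lmax l))
    (hpos : ∀ k, 0 < ∑ l, C l k * lmin l)
    -- noise constants
    (α σv : ℝ) (hα : 0 ≤ α) :
    -- the unique minimizer `wo` of the aggregate cost, which is Pareto optimal
    ∃ wo : DiffusionPareto.Vec M,
      (∀ w, w ≠ wo → ∑ l, J l wo < ∑ l, J l w) ∧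
      DiffusionPareto.IsParetoOptimal Jo wo ∧
      -- for sufficiently small step sizes whose ratio `β = μ_min / μ_max` is bounded below
      ∀ β₀ : ℝ, 0 < β₀ →
      ∃ μ₀ : ℝ, 0 < μ₀ ∧ ∃ K₁ K₂ : ℝ,
      ∀ μ : Fin N → ℝ, (∀ k, 0 < μ k) →
        DiffusionPareto.stepMax μ ≤ μ₀ →
        β₀ ≤ DiffusionPareto.stepMin μ / DiffusionPareto.stepMax μ →
      -- the unique fixed point `winf` of the noise-free diffusion operator
      ∃ winf : DiffusionPareto.BlockVec N M,
        (∀ x, DiffusionPareto.diffusion A₁ A₂ C J μ x = x ↔ x = winf) ∧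
        -- the bound on the mean-square perturbation is well defined
        IsUnit (1 - A₂ᵀ * DiffusionPareto.gammaD C lmin lmax α μ * A₁ᵀ) ∧
        0 < DiffusionPareto.boundDenom C lmin lmax α μ ∧
        -- and it is `O(μ_max)`
        ‖DiffusionPareto.mspUpper A₁ A₂ C lmin lmax α μ
            (DiffusionPareto.noiseVector A₁ J lmax α σv wo winf)‖ ≤
          DiffusionPareto.colSumNorm C ^ 2 *
              ‖DiffusionPareto.noiseVector A₁ J lmax α σv wo winf‖ *
              DiffusionPareto.stepMax μ / DiffusionPareto.boundDenom C lmin lmax α μ ∧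
        DiffusionPareto.colSumNorm C ^ 2 *
              ‖DiffusionPareto.noiseVector A₁ J lmax α σv wo winf‖ *
              DiffusionPareto.stepMax μ / DiffusionPareto.boundDenom C lmin lmax α μ ≤
          K₁ * DiffusionPareto.stepMax μ ∧
        -- the bias is `O(μ_max²)`
        (DiffusionPareto.SmallBiasCondition A₁ A₂ C μ →
          ∑ k, ‖wo - winf k‖ ^ 2 ≤ K₂ * DiffusionPareto.stepMax μ ^ 2) ∧
        -- every stochastic diffusion process with these step sizes
        ∀ (Ω : Type*) [MeasurableSpace Ω] (Pr : Measure Ω) [IsProbabilityMeasure Pr]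
          (v : ℕ → Fin N → DiffusionPareto.Vec M → Ω → DiffusionPareto.Vec M)
          (w : ℕ → Ω → DiffusionPareto.BlockVec N M),
          DiffusionPareto.IsDiffusionProcess Pr A₁ A₂ C J μ α σv v w →
          (∀ i, MemLp (w i) 2 Pr) ∧
          IsBoundedUnder (· ≤ ·) atTop
            (fun i => ‖DiffusionPareto.meanPower Pr (fun ω => w i ω - winf)‖) ∧
          IsBoundedUnder (· ≤ ·) atTop
            (fun i => ‖DiffusionPareto.meanPower Pr (fun ω => (fun _ => wo) - w i ω)‖) ∧
          -- steady-state mean-square perturbation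
          limsup (fun i => ‖DiffusionPareto.meanPower Pr (fun ω => w i ω - winf)‖) atTop ≤
            ‖DiffusionPareto.mspUpper A₁ A₂ C lmin lmax α μ
              (DiffusionPareto.noiseVector A₁ J lmax α σv wo winf)‖ ∧
          -- steady-state mean-square error
          limsup (fun i => ‖DiffusionPareto.meanPower Pr (fun ω => (fun _ => wo) - w i ω)‖) atTop ≤
            2 * ‖DiffusionPareto.power ((fun _ => wo) - winf)‖ +
              2 * limsup (fun i => ‖DiffusionPareto.meanPower Pr (fun ω => w i ω - winf)‖) atTop ∧
          (DiffusionPareto.SmallBiasCondition A₁ A₂ C μ →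
            limsup (fun i => ‖DiffusionPareto.meanPower Pr (fun ω => (fun _ => wo) - w i ω)‖)
                atTop ≤
              2 * K₁ * DiffusionPareto.stepMax μ + 2 * K₂ * DiffusionPareto.stepMax μ ^ 2) := by
  have h : DiffusionPareto.IsNetwork A₁ A₂ C J lmin lmax :=
    ⟨hA₁, hA₂, hC, hlmin, hHess, hpos⟩
  obtain ⟨wo, hgrad, hmin⟩ := h.exists_minimizer
  refine ⟨wo, hmin, DiffusionPareto.isParetoOptimal_of_minimizer hπ hJ hmin, fun β₀ hβ₀ => ?_⟩
  have hσ := h.sigmaMin_pos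
  have hσ' := hσ.trans_le h.sigmaMin_le_sigmaMax
  have hg : 0 ≤ DiffusionPareto.noiseGain C lmax α := DiffusionPareto.noiseGain_nonneg hα
  set G := ∑ k, ‖gradient (DiffusionPareto.localCost C J k) wo‖ with hG
  set R := G / (β₀ * DiffusionPareto.sigmaMin C lmin) with hR
  set B := 4 * α * (⨆ k, lmax k) ^ 2 * R ^ 2 +
    ⨆ k, (2 * α * ‖gradient (J k) wo‖ ^ 2 + σv ^ 2) with hB
  obtain ⟨K₂, hK₂⟩ := h.exists_sum_sq_le hgrad R
  -- The first threshold gives the contraction. The second lets the quadratic terms consume at most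
  -- half of `2 β₀ σ_min`, so the denominator stays above `β₀ σ_min`, the denominator of `K₁`.
  refine ⟨min (1 / DiffusionPareto.sigmaMax C lmax) (β₀ * DiffusionPareto.sigmaMin C lmin /
    (DiffusionPareto.sigmaMax C lmax ^ 2 + DiffusionPareto.noiseGain C lmax α)), by positivity,
    DiffusionPareto.colSumNorm C ^ 2 * B / (β₀ * DiffusionPareto.sigmaMin C lmin), K₂,
    fun μ hμ hμ₀ hβ => ?_⟩
  have hm := DiffusionPareto.stepMax_pos hμ
  have hs₁ := (le_div_iff₀ hσ').1 (hμ₀.trans (min_le_left _ _))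
  have hs₂ := (le_div_iff₀ (by positivity)).1 (hμ₀.trans (min_le_right _ _))
  have hden := h.le_boundDenom hβ hs₂
  have hden0 : 0 < β₀ * DiffusionPareto.sigmaMin C lmin := by positivity
  have hd := hden0.trans_le hden
  obtain ⟨winf, hwinf⟩ := h.exists_fixedPoint hμ hs₁
  have hfix := (hwinf winf).2 rfl
  have hdist : ‖winf - fun _ => wo‖ ≤ R := h.norm_fixedPoint_sub_le hμ hs₁ hβ₀ hβ hfix wo
    fun k => Finset.single_le_sum
      (f := fun k => ‖gradient (DiffusionPareto.localCost C J k) wo‖)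
      (fun _ _ => norm_nonneg _) (Finset.mem_univ k)
  have hbv := DiffusionPareto.norm_noiseVector_le (J := J) (lmax := lmax) (σv := σv) hA₁ hα hdist
  have hub := h.norm_mspUpper_le hα hμ hd (DiffusionPareto.noiseVector A₁ J lmax α σv wo winf)
  have hK₁ : DiffusionPareto.colSumNorm C ^ 2 *
      ‖DiffusionPareto.noiseVector A₁ J lmax α σv wo winf‖ * DiffusionPareto.stepMax μ /
        DiffusionPareto.boundDenom C lmin lmax α μ ≤
      DiffusionPareto.colSumNorm C ^ 2 * B / (β₀ * DiffusionPareto.sigmaMin C lmin) *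
        DiffusionPareto.stepMax μ := by
    have hB0 : 0 ≤ B := (norm_nonneg _).trans hbv
    rw [div_mul_eq_mul_div]
    exact div_le_div₀ (by positivity) (by gcongr) hden0 hden
  refine ⟨winf, hwinf, h.isUnit_one_sub hα hμ hd, hd, hub, hK₁,
    fun hsb => hK₂ μ winf hμ hsb hfix hdist, ?_⟩
  intro Ω _ Pr _ v w hp
  have hmem := hp.memLp h hμ
  obtain ⟨D, hD⟩ := hp.norm_meanPower_le h hμ hα hd wo hfix
  have hρ0 := (DiffusionPareto.gammaDAt_nonneg hα 0).trans (h.gammaDAt_le hα hμ 0)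
  obtain ⟨hb₁, hl₁⟩ := DiffusionPareto.limsup_le_of_le_add_pow_mul (fun i => norm_nonneg _) hρ0
    (sub_lt_self _ (mul_pos hm hd)) hD
  obtain ⟨hb₂, hl₂⟩ := DiffusionPareto.limsup_le_add_mul_limsup (fun i => norm_nonneg _)
    (fun i => norm_nonneg _) zero_le_two hb₁
    fun i => DiffusionPareto.norm_meanPower_sub_le (hmem i) winf fun _ => wo
  refine ⟨hmem, hb₁, hb₂, hl₁, hl₂, fun hsb => hl₂.trans ?_⟩
  have hbias := hK₂ μ winf hμ hsb hfix hdist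
  have hpow : ‖DiffusionPareto.power ((fun _ => wo) - winf)‖ ≤
      K₂ * DiffusionPareto.stepMax μ ^ 2 := by
    refine (pi_norm_le_iff_of_nonneg
      ((Finset.sum_nonneg fun k _ => sq_nonneg ‖wo - winf k‖).trans hbias)).2 fun k => ?_
    rw [DiffusionPareto.power, Real.norm_of_nonneg (sq_nonneg _)]
    exact (Finset.single_le_sum (f := fun k => ‖wo - winf k‖ ^ 2) (fun _ _ => sq_nonneg _)
      (Finset.mem_univ k)).trans hbias
  linarith [hl₁.trans (hub.trans hK₁)]
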